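/- **Setting.** Let $X,Y$ be count variables (with values in $\{0,1,2,\dots\}$) with distribution functions $F,G$ (so $F(-1)=G(-1)=0$) and masses at zero $p_1=P(X=0)=F(0)$ and $p_2=P(Y=0)=G(0)$. For a joint law of $(X,Y)$ with independent copies $(X_i,Y_i)$, $i=1,2,3$, let $$\rho_S=3P\bigl((X_1-X_2)(Y_1-Y_3)>0\bigr)-3P\bigl((X_1-X_2)(Y_1-Y_3)<0\bigr).$$ Let $\rho_S^{\max}$, $\rho_S^{\min}$ be the largest and the smallest value of $\rho_S$ over all joint laws with margins $F,G$ (both are attained). For a joint law with $P(X>0,Y>0)>0$ let $X_{11}$, $Y_{11}$ have the conditional laws of $X$, respectively $Y$, given $\{X>0,Y>0\}$. Let $\rho_{S_{11}}^{\max}$ be the sharp upper bound (supremum) of Spearman's rho over all joint laws whose margins are the laws that $X_{11}$ and $Y_{11}$ have when $P(X\le x,Y\le y)=\min\{F(x),G(y)\}$, and let $\rho_{S_{11}}^{\min}$ be the sharp lower bound (infimum) over all joint laws whose margins are the laws that $X_{11}$ and $Y_{11}$ have when $P(X\le x,Y\le y)=\max\{F(x)+G(y)-1,0\}$. Let $\tilde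 s,\tilde u,\tilde t,\tilde v$ be nonnegative integers with $$F(\tilde s-1)\le p_2<F(\tilde s),\quad G(\tilde u-1)<F(\tilde s)\le G(\tilde u)\qquad\text{if }p_1\le p_2,$$ $$G(\tilde t-1)\le p_1<G(\tilde t),\quad F(\tilde v-1)<G(\tilde t)\le F(\tilde v)\qquad\text{if }p_1>p_2;$$ if no such $\tilde u$ exists (that is, $G(y)<F(\tilde s)$ for all $y$), read $G(\tilde u)=G(\tilde u-1)=1$, and similarly, if no such $\tilde v$ exists, read $F(\tilde v)=F(\tilde v-1)=1$. If $p_1+p_2<1$, let $\tilde s',\tilde u',\tilde t',\tilde v'$ be nonnegative integers with $$F(\tilde s'-1)\le 1-p_2<F(\tilde s'),\qquad G(\tilde u'-1)\le 1-F(\tilde s'-1)<G(\tilde u'),$$ $$G(\tilde t'-1)\le 1-p_1<G(\tilde t'),\qquad F(\tilde v'-1)\le 1-G(\tilde t'-1)<F(\tilde v'),$$ and put $I_1=\min\{1-p_2,F(\tilde v')\}$, $I_2=\min\{1-p_1,G(\tilde u')\}$, $w(x,y)=1-F(x)-G(y)$. (If $0<p_1,p_2<1$, then all these points except possibly $\tilde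 u,\tilde v$ exist.) **Proposition.** Whenever the points that occur exist (with the above reading for $\tilde u$, $\tilde v$): 1. If $p_1\le p_2$, $$\rho_S^{\max}=(1-p_2)^3\rho_{S_{11}}^{\max}+3p_2(1-p_2)+3\bigl(p_2-F(\tilde s-1)\bigr)\Bigl(F(\tilde s)\bigl(p_2-G(\tilde u)-G(\tilde u-1)\bigr)+G(\tilde u)G(\tilde u-1)\Bigr).$$ 2. If $p_1>p_2$, $$\rho_S^{\max}=(1-p_1)^3\rho_{S_{11}}^{\max}+3p_1(1-p_1)+3\bigl(p_1-G(\tilde t-1)\bigr)\Bigl(G(\tilde t)\bigl(p_1-F(\tilde v)-F(\tilde v-1)\bigr)+F(\tilde v)F(\tilde v-1)\Bigr).$$ 3. If $p_1+p_2\ge1$, $\ \rho_S^{\min}=-3(1-p_1)(1-p_2)$. 4. If $p_1+p_2<1$, $$\begin{aligned}\rho_S^{\min}={}&w(0,0)^3\rho_{S_{11}}^{\min}+3w(0,0)(p_1p_2-p_1-p_2)-3p_1p_2+3\,w(\tilde s'-1,\tilde u'-1)\,w(\tilde s',0)\,w(0,\tilde t')\,\mathbb 1(\tilde s'=\tilde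 v')\\&-3w(\tilde s',0)\bigl[p_2w(\tilde s'-1,0)+(G(\tilde u'-1)-p_2)^2+w(\tilde s'-1,\tilde u'-1)(I_2-2p_2+G(\tilde u'-1))\bigr]\\&-3w(0,\tilde t')\bigl[p_1w(0,\tilde t'-1)+(F(\tilde v'-1)-p_1)^2+w(\tilde v'-1,\tilde t'-1)(I_1-2p_1+F(\tilde v'-1))\bigr].\end{aligned}$$ -/

import Mathlib

open MeasureTheory

noncomputable section

namespace ZeroInflated

/-- Distribution function of a law on the nonnegative integers, as a function on `ℤ`
(so that it vanishes at `-1`). -/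
def cdfZ (μ : Measure ℕ) (x : ℤ) : ℝ := μ.real {n : ℕ | (n : ℤ) ≤ x}

/-- Spearman's rho of a pair `(X, Y)` with joint law `π`: for three independent copies
`(X₁, Y₁), (X₂, Y₂), (X₃, Y₃)` of the pair it equals
`3 P((X₁ - X₂)(Y₁ - Y₃) > 0) - 3 P((X₁ - X₂)(Y₁ - Y₃) < 0)`. -/
def spearmanRho (π : Measure (ℕ × ℕ)) : ℝ :=
  3 * (π.prod (π.prod π)).real
      {z | ((z.1.1 : ℤ) - (z.2.1.1 : ℤ)) * ((z.1.2 : ℤ) - (z.2.2.2 : ℤ)) > 0}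
  - 3 * (π.prod (π.prod π)).real
      {z | ((z.1.1 : ℤ) - (z.2.1.1 : ℤ)) * ((z.1.2 : ℤ) - (z.2.2.2 : ℤ)) < 0}

/-- The values of Spearman's rho over all joint laws with margins `μ` and `ν`. -/
def rhoRange (μ ν : Measure ℕ) : Set ℝ :=
  {r | ∃ π : Measure (ℕ × ℕ), π.map Prod.fst = μ ∧ π.map Prod.snd = ν ∧ spearmanRho π = r}

/-- The quantile function of a law on `ℕ`. -/
def quantile (μ : Measure ℕ) (u : ℝ) : ℕ := sInf {n : ℕ | u ≤ cdfZ μ n}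

/-- The joint law with margins `μ`, `ν` and joint distribution function `min (F x) (G y)`
(see `frechetUpper_apply`). -/
def frechetUpper (μ ν : Measure ℕ) : Measure (ℕ × ℕ) :=
  ((volume : Measure ℝ).restrict (Set.Ioo 0 1)).map (fun u => (quantile μ u, quantile ν u))

/-- The joint law with margins `μ`, `ν` and joint distribution function
`max (F x + G y - 1) 0` (see `frechetLower_apply`). -/
def frechetLower (μ ν : Measure ℕ) : Measure (ℕ × ℕ) :=
  ((volume : Measure ℝ).restrict (Set.Ioo 0 1)).map (fun u => (quantile μ u, quantile ν (1 - u)))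

/-- The conditional joint law of `(X, Y)` given `X > 0` and `Y > 0`; its margins are the laws of
the positive parts `X₁₁` and `Y₁₁`. -/
def positivePart (π : Measure (ℕ × ℕ)) : Measure (ℕ × ℕ) :=
  ProbabilityTheory.cond π {z | 0 < z.1 ∧ 0 < z.2}

/-- The sharp upper bound on Spearman's rho for pairs of positive variables whose margins are the
laws of `X₁₁` and `Y₁₁` under the upper Fréchet–Hoeffding joint law. -/
def rhoPosMax (μ ν : Measure ℕ) : ℝ :=
  sSup (rhoRange ((positivePart (frechetUpper μ ν)).map Prod.fst)
    ((positivePart (frechetUpper μ ν)).map Prod.snd))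

/-- The sharp lower bound on Spearman's rho for pairs of positive variables whose margins are the
laws of `X₁₁` and `Y₁₁` under the lower Fréchet–Hoeffding joint law. -/
def rhoPosMin (μ ν : Measure ℕ) : ℝ :=
  sInf (rhoRange ((positivePart (frechetLower μ ν)).map Prod.fst)
    ((positivePart (frechetLower μ ν)).map Prod.snd))

lemma cdfZ_mono (μ : Measure ℕ) [IsProbabilityMeasure μ] : Monotone (cdfZ μ) := fun _ _ h =>
  measureReal_mono (fun _ hn => le_trans hn h)

lemma exists_lt_cdfZ (μ : Measure ℕ) [IsProbabilityMeasure μ] {c : ℝ} (hc : c < 1) :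
    ∃ n : ℕ, c < cdfZ μ n := by
  have h : Filter.Tendsto (fun n : ℕ => cdfZ μ n) Filter.atTop (nhds 1) := by
    have h0 := tendsto_measure_iUnion_atTop (μ := μ) (s := fun n : ℕ => {k : ℕ | (k : ℤ) ≤ n})
      (fun a b hab k (hk : (k : ℤ) ≤ a) => show (k : ℤ) ≤ b from
        le_trans hk (by exact_mod_cast hab))
    have hU : (⋃ n : ℕ, {k : ℕ | (k : ℤ) ≤ n}) = Set.univ := by
      ext k; simpa using ⟨k, le_rfl⟩
    rw [hU, measure_univ] at h0
    have h1 := (ENNReal.tendsto_toReal ENNReal.one_ne_top).comp h0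
    rw [ENNReal.toReal_one] at h1
    exact h1
  exact (h.eventually (lt_mem_nhds hc)).exists

/-- The points entering the bounds exist: every level in `[0, 1)` is crossed exactly once. -/
lemma existsUnique_crossing (μ : Measure ℕ) [IsProbabilityMeasure μ] {c : ℝ} (h0 : 0 ≤ c)
    (hc : c < 1) : ∃! n : ℕ, cdfZ μ ((n : ℤ) - 1) ≤ c ∧ c < cdfZ μ n := by
  classical
  have hex := exists_lt_cdfZ μ hc
  have hneg : cdfZ μ (-1) = 0 := by
    have : {n : ℕ | (n : ℤ) ≤ -1} = ∅ := by
      ext n; simp; omega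
    simp [cdfZ, this]
  refine ⟨Nat.find hex, ⟨?_, Nat.find_spec hex⟩, ?_⟩
  · rcases hk : Nat.find hex with _ | k
    · simpa [hneg] using h0
    · have := Nat.find_min hex (m := k) (by omega)
      push_cast
      simpa using this
  · rintro m ⟨h1, h2⟩
    symm
    rw [Nat.find_eq_iff]
    refine ⟨h2, fun k hk => not_lt.2 (le_trans (cdfZ_mono μ (by omega)) h1)⟩

lemma quantile_le_iff (μ : Measure ℕ) [IsProbabilityMeasure μ] {u : ℝ} (hu : u < 1) (n : ℕ) :
    quantile μ u ≤ n ↔ u ≤ cdfZ μ n := by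
  obtain ⟨m, hm⟩ := exists_lt_cdfZ μ hu
  constructor
  · intro h
    have : u ≤ cdfZ μ (quantile μ u : ℕ) :=
      Nat.sInf_mem (s := {n : ℕ | u ≤ cdfZ μ n}) ⟨m, hm.le⟩
    exact this.trans (cdfZ_mono μ (by exact_mod_cast h))
  · intro h
    exact Nat.sInf_le h

lemma aemeasurable_quantile (μ : Measure ℕ) [IsProbabilityMeasure μ] :
    AEMeasurable (quantile μ) ((volume : Measure ℝ).restrict (Set.Ioo 0 1)) := by
  refine aemeasurable_restrict_of_monotoneOn measurableSet_Ioo ?_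
  intro a _ b hb hab
  rw [quantile_le_iff μ (hab.trans_lt hb.2)]
  exact hab.trans ((quantile_le_iff μ hb.2 _).1 le_rfl)

lemma aemeasurable_quantile_sub (μ : Measure ℕ) [IsProbabilityMeasure μ] :
    AEMeasurable (fun u => quantile μ (1 - u)) ((volume : Measure ℝ).restrict (Set.Ioo 0 1)) := by
  refine aemeasurable_restrict_of_antitoneOn measurableSet_Ioo ?_
  intro a ha b hb hab
  show quantile μ (1 - b) ≤ quantile μ (1 - a)
  rw [quantile_le_iff μ (by linarith [hb.1])]
  have := (quantile_le_iff μ (u := 1 - a) (by linarith [ha.1]) _).1 le_rfl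
  linarith

lemma cdfZ_le_one (μ : Measure ℕ) [IsProbabilityMeasure μ] (x : ℤ) : cdfZ μ x ≤ 1 :=
  measureReal_le_one

lemma cdfZ_nonneg (μ : Measure ℕ) (x : ℤ) : 0 ≤ cdfZ μ x :=
  measureReal_nonneg

lemma frechetUpper_apply (μ ν : Measure ℕ) [IsProbabilityMeasure μ] [IsProbabilityMeasure ν]
    (x y : ℕ) :
    (frechetUpper μ ν).real {z | z.1 ≤ x ∧ z.2 ≤ y} = min (cdfZ μ x) (cdfZ ν y) := by
  have hset : (fun u => (quantile μ u, quantile ν u)) ⁻¹' {z : ℕ × ℕ | z.1 ≤ x ∧ z.2 ≤ y}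
      ∩ Set.Ioo 0 1 = Set.Ioc 0 (min (cdfZ μ x) (cdfZ ν y)) ∩ Set.Iio 1 := by
    ext u
    simp only [Set.mem_inter_iff, Set.mem_preimage, Set.mem_ofPred_eq, Set.mem_Ioo, Set.mem_Ioc,
      Set.mem_Iio, le_min_iff]
    constructor
    · rintro ⟨⟨h1, h2⟩, h3, h4⟩
      exact ⟨⟨h3, (quantile_le_iff μ h4 x).1 h1, (quantile_le_iff ν h4 y).1 h2⟩, h4⟩
    · rintro ⟨⟨h3, h1, h2⟩, h4⟩
      exact ⟨⟨(quantile_le_iff μ h4 x).2 h1, (quantile_le_iff ν h4 y).2 h2⟩, h3, h4⟩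
  rw [frechetUpper, measureReal_def, Measure.map_apply_of_aemeasurable
    ((aemeasurable_quantile μ).prodMk (aemeasurable_quantile ν)) (Set.to_countable _).measurableSet,
    Measure.restrict_apply' measurableSet_Ioo, hset]
  have hb : min (cdfZ μ x) (cdfZ ν y) ≤ 1 := (min_le_left _ _).trans (cdfZ_le_one μ x)
  have h0 : 0 ≤ min (cdfZ μ x) (cdfZ ν y) := le_min (cdfZ_nonneg μ x) (cdfZ_nonneg ν y)
  have : volume (Set.Ioc 0 (min (cdfZ μ x) (cdfZ ν y)) ∩ Set.Iio 1)
      = volume (Set.Ioo (0 : ℝ) (min (cdfZ μ x) (cdfZ ν y))) := by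
    apply le_antisymm
    · rw [Real.volume_Ioo, ← Real.volume_Ioc]
      exact measure_mono Set.inter_subset_left
    · exact measure_mono fun u hu => ⟨⟨hu.1, hu.2.le⟩, hu.2.trans_le hb⟩
  rw [this, Real.volume_Ioo, sub_zero, ENNReal.toReal_ofReal h0]

lemma frechetLower_apply (μ ν : Measure ℕ) [IsProbabilityMeasure μ] [IsProbabilityMeasure ν]
    (x y : ℕ) :
    (frechetLower μ ν).real {z | z.1 ≤ x ∧ z.2 ≤ y} = max (cdfZ μ x + cdfZ ν y - 1) 0 := by
  have hset : (fun u => (quantile μ u, quantile ν (1 - u))) ⁻¹' {z : ℕ × ℕ | z.1 ≤ x ∧ z.2 ≤ y}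
      ∩ Set.Ioo 0 1 = Set.Icc (1 - cdfZ ν y) (cdfZ μ x) ∩ Set.Ioo 0 1 := by
    ext u
    simp only [Set.mem_inter_iff, Set.mem_preimage, Set.mem_ofPred_eq, Set.mem_Ioo, Set.mem_Icc]
    constructor
    · rintro ⟨⟨h1, h2⟩, h3, h4⟩
      have h5 := (quantile_le_iff ν (u := 1 - u) (by linarith) y).1 h2
      exact ⟨⟨by linarith, (quantile_le_iff μ h4 x).1 h1⟩, h3, h4⟩
    · rintro ⟨⟨h1, h2⟩, h3, h4⟩
      exact ⟨⟨(quantile_le_iff μ h4 x).2 h2,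
        (quantile_le_iff ν (u := 1 - u) (by linarith) y).2 (by linarith)⟩, h3, h4⟩
  rw [frechetLower, measureReal_def, Measure.map_apply_of_aemeasurable
    ((aemeasurable_quantile μ).prodMk (aemeasurable_quantile_sub ν))
    (Set.to_countable _).measurableSet,
    Measure.restrict_apply' measurableSet_Ioo, hset]
  have : volume (Set.Icc (1 - cdfZ ν y) (cdfZ μ x) ∩ Set.Ioo 0 1)
      = volume (Set.Ioo (1 - cdfZ ν y) (cdfZ μ x)) := by
    apply le_antisymm
    · rw [Real.volume_Ioo, ← Real.volume_Icc]
      exact measure_mono Set.inter_subset_left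
    · refine measure_mono fun u hu => ⟨⟨hu.1.le, hu.2.le⟩, ?_, ?_⟩
      · linarith [hu.1, cdfZ_le_one ν y]
      · linarith [hu.2, cdfZ_le_one μ x]
  rw [this, Real.volume_Ioo, ENNReal.toReal_ofReal']
  congr 1
  ring

end ZeroInflated

end

noncomputable section

namespace ZeroInflated

/-! Given the first copy, the other two are independent, so rho is `3 * ∫ grade(X) * grade(Y)`
(`spearmanRho_eq_integral`). Integrating out the first copy first instead shows that, for fixed
margins, rho is increasing in the joint distribution function (`spearmanRho_mono`). Hence a law
carried by an increasing set is maximal and one carried by a decreasing set is minimal among laws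
with its margins. The Fréchet laws have these supports, and conditioning on positivity preserves
them. So the extremal rho, both for the original margins and for those of the positive parts, is
attained by an explicit law driven by a single uniform level `u`.

The proposition thereby compares two one-dimensional integrals. For the original margins the
integrand is a product of the step functions `score`. For the positive parts it is the same product
over a subinterval, with the distribution functions truncated to that interval (`rhoPosMax_eq`,
`rhoPosMin_eq`). Truncation changes a score by a constant, except on an end interval: an atom
straddling the truncation level is cut, and this shifts the score there by a second constant
(`clip_add_clip_eq_score`, `clip_add_clip_eq_score_of_lt`). `integral_mul_shift` expands the product
of shifted scores. What remains are primitives of single scores, which telescope to `F ^ 2 - F` at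
jump levels and are linear in between (`integral_score`). Outside the subinterval one coordinate is
zero, so its score is constant. The crossing points in the formulas record the cut atoms and the
steps on which these primitives are evaluated. -/

/-! ### Signs, grades and the integral form of Spearman's rho. -/

/-- The grade `F x + F (x - 1) - 1`. -/
def grade (μ : Measure ℕ) (x : ℤ) : ℝ := cdfZ μ x + cdfZ μ (x - 1) - 1

/-- The joint distribution function of a law on `ℕ × ℕ`, on `ℤ × ℤ`. -/
def jointCdf (π : Measure (ℕ × ℕ)) (x y : ℤ) : ℝ :=
  π.real {z : ℕ × ℕ | (z.1 : ℤ) ≤ x ∧ (z.2 : ℤ) ≤ y}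

lemma integrable_of_abs_le {α : Type*} [MeasurableSpace α] [Countable α]
    [MeasurableSingletonClass α] (π : Measure α) [IsFiniteMeasure π] {f : α → ℝ} (C : ℝ)
    (hf : ∀ z, |f z| ≤ C) : Integrable f π :=
  Integrable.of_bound (measurable_of_countable f).aestronglyMeasurable C
    (Filter.Eventually.of_forall hf)

lemma cast_sign_eq (k : ℤ) :
    ((k.sign : ℤ) : ℝ) = (if 0 < k then 1 else 0) - (if k < 0 then 1 else 0) := by
  rcases lt_trichotomy k 0 with h | h | h
  · simp [Int.sign_eq_neg_one_of_neg h, h, not_lt.2 h.le]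
  · simp [h]
  · simp [Int.sign_eq_one_of_pos h, h, not_lt.2 h.le]

lemma cast_sign_sub (x y : ℤ) :
    (((x - y).sign : ℤ) : ℝ) = (if y ≤ x then 1 else 0) + (if y ≤ x - 1 then 1 else 0) - 1 := by
  rw [cast_sign_eq]
  split_ifs <;> first | omega | norm_num

lemma abs_cast_sign_le (k : ℤ) : |((k.sign : ℤ) : ℝ)| ≤ 1 := by
  rcases lt_trichotomy k 0 with h | h | h
  · simp [Int.sign_eq_neg_one_of_neg h]
  · simp [h]
  · simp [Int.sign_eq_one_of_pos h]

lemma abs_sign_mul_sign_le (k l : ℤ) : |((k.sign : ℤ) : ℝ) * ((l.sign : ℤ) : ℝ)| ≤ 1 := by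
  rw [abs_mul]
  exact mul_le_one₀ (abs_cast_sign_le k) (abs_nonneg _) (abs_cast_sign_le l)

lemma integral_ite_one {α : Type*} [MeasurableSpace α] [Countable α]
    [MeasurableSingletonClass α] (π : Measure α) (p : α → Prop) [DecidablePred p] :
    ∫ z, (if p z then (1 : ℝ) else 0) ∂π = π.real {z | p z} := by
  rw [← integral_indicator_one (Set.to_countable _).measurableSet]
  congr 1
  ext z
  simp [Set.indicator_apply]

lemma integrable_ite_one {α : Type*} [MeasurableSpace α] [Countable α]
    [MeasurableSingletonClass α] (π : Measure α) [IsFiniteMeasure π] (p : α → Prop)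
    [DecidablePred p] : Integrable (fun z => if p z then (1 : ℝ) else 0) π :=
  integrable_of_abs_le π 1 fun z => by split_ifs <;> simp

lemma grade_eq_integral (μ : Measure ℕ) [IsProbabilityMeasure μ] (x : ℤ) :
    grade μ x = ∫ n : ℕ, (((x - n).sign : ℤ) : ℝ) ∂μ := by
  simp_rw [cast_sign_sub]
  rw [integral_sub _ (integrable_const _), integral_add (integrable_ite_one _ _)
    (integrable_ite_one _ _), integral_ite_one, integral_ite_one]
  · simp [grade, cdfZ]
  · exact (integrable_ite_one _ _).add (integrable_ite_one _ _)

lemma abs_grade_le (μ : Measure ℕ) [IsProbabilityMeasure μ] (x : ℤ) : |grade μ x| ≤ 1 := by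
  have := cdfZ_le_one μ x
  have := cdfZ_le_one μ (x - 1)
  have := cdfZ_nonneg μ x
  have := cdfZ_nonneg μ (x - 1)
  rw [abs_le, grade]
  constructor <;> linarith

/-- Swapping two independent copies reverses the sign of their difference, so the integral equals
its own negative. -/
lemma integral_grade (μ : Measure ℕ) [IsProbabilityMeasure μ] :
    ∫ n : ℕ, grade μ n ∂μ = 0 := by
  have h : ∫ n : ℕ, grade μ n ∂μ = - ∫ n : ℕ, grade μ n ∂μ := by
    simp_rw [grade_eq_integral]
    conv_lhs => rw [integral_integral_swap (f := fun a b : ℕ => ((((a : ℤ) - b).sign : ℤ) : ℝ))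
      (integrable_of_abs_le _ 1 fun z => abs_cast_sign_le _)]
    rw [← integral_neg]
    congr 1
    ext n
    rw [← integral_neg]
    congr 1
    ext m
    rw [← neg_sub (n : ℤ) m, Int.sign_neg]
    push_cast
    ring
  linarith

lemma spearmanRho_eq_integral_sign (π : Measure (ℕ × ℕ)) [IsProbabilityMeasure π] :
    spearmanRho π = 3 * ∫ z, ((((z.1.1 : ℤ) - z.2.1.1).sign : ℤ) : ℝ)
      * ((((z.1.2 : ℤ) - z.2.2.2).sign : ℤ) : ℝ) ∂(π.prod (π.prod π)) := by
  rw [spearmanRho, ← mul_sub, ← integral_ite_one, ← integral_ite_one,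
    ← integral_sub (integrable_ite_one _ _) (integrable_ite_one _ _)]
  congr 2
  ext z
  rw [← Int.cast_mul, ← Int.sign_mul, cast_sign_eq]

/-- With the first copy fixed, the two signs involve independent copies, so the inner integral
factors into the two grades. -/
lemma spearmanRho_eq_integral (π : Measure (ℕ × ℕ)) [IsProbabilityMeasure π] :
    spearmanRho π
      = 3 * ∫ z, grade (π.map Prod.fst) z.1 * grade (π.map Prod.snd) z.2 ∂π := by
  have : IsProbabilityMeasure (π.map Prod.fst) :=
    Measure.isProbabilityMeasure_map measurable_fst.aemeasurable
  have : IsProbabilityMeasure (π.map Prod.snd) :=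
    Measure.isProbabilityMeasure_map measurable_snd.aemeasurable
  rw [spearmanRho_eq_integral_sign, integral_prod _ (integrable_of_abs_le _ 1 fun z =>
    abs_sign_mul_sign_le _ _)]
  congr 2
  ext z
  rw [integral_prod_mul (f := fun p : ℕ × ℕ => ((((z.1 : ℤ) - p.1).sign : ℤ) : ℝ))
    (g := fun p : ℕ × ℕ => ((((z.2 : ℤ) - p.2).sign : ℤ) : ℝ)), grade_eq_integral,
    grade_eq_integral,
    integral_map measurable_fst.aemeasurable (measurable_of_countable _).aestronglyMeasurable,
    integral_map measurable_snd.aemeasurable (measurable_of_countable _).aestronglyMeasurable]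

/-! ### Joint distribution functions and monotonicity of rho. -/

lemma cdfZ_map_fst (π : Measure (ℕ × ℕ)) (x : ℤ) :
    cdfZ (π.map Prod.fst) x = π.real {z : ℕ × ℕ | (z.1 : ℤ) ≤ x} := by
  rw [cdfZ, map_measureReal_apply measurable_fst (Set.to_countable _).measurableSet]
  rfl

lemma cdfZ_map_snd (π : Measure (ℕ × ℕ)) (x : ℤ) :
    cdfZ (π.map Prod.snd) x = π.real {z : ℕ × ℕ | (z.2 : ℤ) ≤ x} := by
  rw [cdfZ, map_measureReal_apply measurable_snd (Set.to_countable _).measurableSet]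
  rfl

/-- Each sign is one minus two indicators of lower sets. What matters is that every joint term has
coefficient `+1` and the rest depends on the margins alone. -/
lemma integral_sign_mul_sign (π : Measure (ℕ × ℕ)) [IsProbabilityMeasure π] (x y : ℤ) :
    ∫ z : ℕ × ℕ, ((((z.1 : ℤ) - x).sign : ℤ) : ℝ) * ((((z.2 : ℤ) - y).sign : ℤ) : ℝ) ∂π
      = jointCdf π x y + jointCdf π (x - 1) y + jointCdf π x (y - 1)
        + jointCdf π (x - 1) (y - 1)
        - grade (π.map Prod.fst) x - grade (π.map Prod.snd) y - 1 := by
  have h : ∀ z : ℕ × ℕ,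
      ((((z.1 : ℤ) - x).sign : ℤ) : ℝ) * ((((z.2 : ℤ) - y).sign : ℤ) : ℝ)
      = (if (z.1 : ℤ) ≤ x ∧ (z.2 : ℤ) ≤ y then 1 else 0)
        + (if (z.1 : ℤ) ≤ x - 1 ∧ (z.2 : ℤ) ≤ y then 1 else 0)
        + (if (z.1 : ℤ) ≤ x ∧ (z.2 : ℤ) ≤ y - 1 then 1 else 0)
        + (if (z.1 : ℤ) ≤ x - 1 ∧ (z.2 : ℤ) ≤ y - 1 then 1 else 0)
        - ((if (z.1 : ℤ) ≤ x then 1 else 0) + (if (z.1 : ℤ) ≤ x - 1 then 1 else 0))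
        - ((if (z.2 : ℤ) ≤ y then 1 else 0) + (if (z.2 : ℤ) ≤ y - 1 then 1 else 0)) + 1 := by
    intro z
    rw [← neg_sub x, ← neg_sub y, Int.sign_neg, Int.sign_neg]
    push_cast
    rw [neg_mul_neg, cast_sign_sub, cast_sign_sub]
    simp only [ite_and]
    split_ifs <;> norm_num
  simp_rw [h]
  have i := fun p : ℕ × ℕ → Prop => fun _ : DecidablePred p => integrable_ite_one π p
  rw [integral_add, integral_sub, integral_sub, integral_add, integral_add, integral_add,
    integral_add, integral_add]
  · simp only [integral_ite_one, integral_const, grade, cdfZ_map_fst, cdfZ_map_snd, jointCdf]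
    simp
    ring
  all_goals
    repeat' first
      | exact i _ _
      | exact integrable_const _
      | apply Integrable.sub
      | apply Integrable.add

lemma spearmanRho_mono {π π' : Measure (ℕ × ℕ)} [IsProbabilityMeasure π]
    [IsProbabilityMeasure π'] (h₁ : π.map Prod.fst = π'.map Prod.fst)
    (h₂ : π.map Prod.snd = π'.map Prod.snd) (h : ∀ x y, jointCdf π x y ≤ jointCdf π' x y) :
    spearmanRho π ≤ spearmanRho π' := by
  -- Copies two and three enter only through `X₂` and `Y₃`, whose joint law is the product of the
  -- margins. The outer measure is therefore common to both laws.
  have key : ∀ (τ : Measure (ℕ × ℕ)) [IsProbabilityMeasure τ], spearmanRho τ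
      = 3 * ∫ q : ℕ × ℕ, ∫ z : ℕ × ℕ, ((((z.1 : ℤ) - q.1).sign : ℤ) : ℝ)
        * ((((z.2 : ℤ) - q.2).sign : ℤ) : ℝ) ∂τ ∂((τ.map Prod.fst).prod (τ.map Prod.snd)) := by
    intro τ _
    rw [spearmanRho_eq_integral_sign, integral_prod_symm _ (integrable_of_abs_le _ 1 fun z =>
      abs_sign_mul_sign_le _ _), Measure.map_prod_map _ _ measurable_fst measurable_snd,
      integral_map (measurable_of_countable _).aemeasurable
        (measurable_of_countable _).aestronglyMeasurable]
    rfl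
  rw [key π, key π', h₁, h₂]
  have := Measure.isProbabilityMeasure_map (μ := π') measurable_fst.aemeasurable
  have := Measure.isProbabilityMeasure_map (μ := π') measurable_snd.aemeasurable
  have hb : ∀ (τ : Measure (ℕ × ℕ)) [IsProbabilityMeasure τ] (q : ℕ × ℕ),
      |∫ z : ℕ × ℕ, ((((z.1 : ℤ) - q.1).sign : ℤ) : ℝ)
        * ((((z.2 : ℤ) - q.2).sign : ℤ) : ℝ) ∂τ| ≤ 1 := by
    intro τ _ q
    have := norm_integral_le_of_norm_le_const (μ := τ) (C := 1)
      (f := fun z : ℕ × ℕ => ((((z.1 : ℤ) - q.1).sign : ℤ) : ℝ)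
        * ((((z.2 : ℤ) - q.2).sign : ℤ) : ℝ))
      (Filter.Eventually.of_forall fun z => abs_sign_mul_sign_le _ _)
    simpa using this
  refine mul_le_mul_of_nonneg_left (integral_mono (integrable_of_abs_le _ 1 (hb π))
    (integrable_of_abs_le _ 1 (hb π')) fun q => ?_) (by norm_num)
  simp only [integral_sign_mul_sign, h₁, h₂]
  have a := h q.1 q.2
  have b := h (q.1 - 1) q.2
  have c := h q.1 (q.2 - 1)
  have d := h (q.1 - 1) (q.2 - 1)
  linarith

/-! ### Monotone supports and extremality. -/

/-- Joint laws concentrated on an increasing set. -/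
def Comonotone (π : Measure (ℕ × ℕ)) : Prop :=
  ∀ x y : ℤ, π {z | (z.1 : ℤ) ≤ x ∧ y < (z.2 : ℤ)} = 0 ∨ π {z | x < (z.1 : ℤ) ∧ (z.2 : ℤ) ≤ y} = 0

/-- Joint laws concentrated on a decreasing set. -/
def Countermonotone (π : Measure (ℕ × ℕ)) : Prop :=
  ∀ x y : ℤ, π {z | (z.1 : ℤ) ≤ x ∧ (z.2 : ℤ) ≤ y} = 0 ∨ π {z | x < (z.1 : ℤ) ∧ y < (z.2 : ℤ)} = 0

/-- This carries the property over to the law conditioned on positivity. -/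
lemma Comonotone.of_absolutelyContinuous {π π' : Measure (ℕ × ℕ)} (h : Comonotone π)
    (hac : π' ≪ π) : Comonotone π' := fun x y => (h x y).imp (fun h => hac h) (fun h => hac h)

lemma Countermonotone.of_absolutelyContinuous {π π' : Measure (ℕ × ℕ)} (h : Countermonotone π)
    (hac : π' ≪ π) : Countermonotone π' :=
  fun x y => (h x y).imp (fun h => hac h) (fun h => hac h)

section

variable (π : Measure (ℕ × ℕ)) [IsProbabilityMeasure π] (x y : ℤ)

lemma cdfZ_fst_eq_add : cdfZ (π.map Prod.fst) x
    = jointCdf π x y + π.real {z | (z.1 : ℤ) ≤ x ∧ y < (z.2 : ℤ)} := by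
  rw [cdfZ_map_fst, jointCdf, ← measureReal_union _ (Set.to_countable _).measurableSet]
  · congr 1
    ext z
    simp only [Set.mem_ofPred_eq, Set.mem_union]
    omega
  · rw [Set.disjoint_left]
    simp only [Set.mem_ofPred_eq]
    omega

lemma cdfZ_snd_eq_add : cdfZ (π.map Prod.snd) y
    = jointCdf π x y + π.real {z | x < (z.1 : ℤ) ∧ (z.2 : ℤ) ≤ y} := by
  rw [cdfZ_map_snd, jointCdf, ← measureReal_union _ (Set.to_countable _).measurableSet]
  · congr 1
    ext z
    simp only [Set.mem_ofPred_eq, Set.mem_union]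
    omega
  · rw [Set.disjoint_left]
    simp only [Set.mem_ofPred_eq]
    omega

lemma cdfZ_add_cdfZ_eq : cdfZ (π.map Prod.fst) x + cdfZ (π.map Prod.snd) y
    = 1 + jointCdf π x y - π.real {z | x < (z.1 : ℤ) ∧ y < (z.2 : ℤ)} := by
  have h : 1 = cdfZ (π.map Prod.fst) x + π.real {z | x < (z.1 : ℤ) ∧ (z.2 : ℤ) ≤ y}
      + π.real {z | x < (z.1 : ℤ) ∧ y < (z.2 : ℤ)} := by
    rw [cdfZ_map_fst, ← measureReal_union _ (Set.to_countable _).measurableSet,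
      ← measureReal_union _ (Set.to_countable _).measurableSet, ← probReal_univ (μ := π)]
    · congr 1
      ext z
      simp only [Set.mem_ofPred_eq, Set.mem_union, Set.mem_univ, true_iff]
      omega
    all_goals
      rw [Set.disjoint_left]
      simp only [Set.mem_ofPred_eq, Set.mem_union]
      omega
  rw [cdfZ_snd_eq_add π x y]
  linarith

end

lemma jointCdf_nonneg (π : Measure (ℕ × ℕ)) (x y : ℤ) : 0 ≤ jointCdf π x y :=
  measureReal_nonneg

lemma isProbabilityMeasure_of_map_fst {π : Measure (ℕ × ℕ)}
    [h : IsProbabilityMeasure (π.map Prod.fst)] : IsProbabilityMeasure π := by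
  refine ⟨?_⟩
  have := h.measure_univ
  rwa [Measure.map_apply measurable_fst MeasurableSet.univ, Set.preimage_univ] at this

/-- At every point the joint distribution function equals one of the two marginal ones, which bound
that of any competitor. -/
lemma Comonotone.isGreatest {π : Measure (ℕ × ℕ)} [IsProbabilityMeasure π] (h : Comonotone π) :
    IsGreatest (rhoRange (π.map Prod.fst) (π.map Prod.snd)) (spearmanRho π) := by
  refine ⟨⟨π, rfl, rfl, rfl⟩, ?_⟩
  rintro r ⟨τ, h₁, h₂, rfl⟩
  have := Measure.isProbabilityMeasure_map (μ := π) measurable_fst.aemeasurable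
  rw [← h₁] at this
  have := isProbabilityMeasure_of_map_fst (π := τ)
  refine spearmanRho_mono h₁ h₂ fun x y => ?_
  rcases h x y with h | h
  · have a := cdfZ_fst_eq_add π x y
    have b := cdfZ_fst_eq_add τ x y
    rw [measureReal_def, h, ENNReal.toReal_zero] at a
    rw [h₁] at b
    have := measureReal_nonneg (μ := τ) (s := {z | (z.1 : ℤ) ≤ x ∧ y < (z.2 : ℤ)})
    linarith
  · have a := cdfZ_snd_eq_add π x y
    have b := cdfZ_snd_eq_add τ x y
    rw [measureReal_def, h, ENNReal.toReal_zero] at a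
    rw [h₂] at b
    have := measureReal_nonneg (μ := τ) (s := {z | x < (z.1 : ℤ) ∧ (z.2 : ℤ) ≤ y})
    linarith

/-- At every point the joint distribution function is either `0` or `F + G - 1`, both lower bounds
for any competitor. -/
lemma Countermonotone.isLeast {π : Measure (ℕ × ℕ)} [IsProbabilityMeasure π]
    (h : Countermonotone π) :
    IsLeast (rhoRange (π.map Prod.fst) (π.map Prod.snd)) (spearmanRho π) := by
  refine ⟨⟨π, rfl, rfl, rfl⟩, ?_⟩
  rintro r ⟨τ, h₁, h₂, rfl⟩
  have := Measure.isProbabilityMeasure_map (μ := π) measurable_fst.aemeasurable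
  rw [← h₁] at this
  have := isProbabilityMeasure_of_map_fst (π := τ)
  refine spearmanRho_mono h₁.symm h₂.symm fun x y => ?_
  rcases h x y with h | h
  · have a : jointCdf π x y = 0 := by rw [jointCdf, measureReal_def, h, ENNReal.toReal_zero]
    rw [a]
    exact jointCdf_nonneg τ x y
  · have a := cdfZ_add_cdfZ_eq π x y
    have b := cdfZ_add_cdfZ_eq τ x y
    rw [measureReal_def, h, ENNReal.toReal_zero] at a
    rw [h₁, h₂] at b
    have := measureReal_nonneg (μ := τ) (s := {z | x < (z.1 : ℤ) ∧ y < (z.2 : ℤ)})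
    linarith

/-! ### Quantile transform and the two Fréchet laws. -/

lemma cdfZ_of_neg (μ : Measure ℕ) {x : ℤ} (hx : x < 0) : cdfZ μ x = 0 := by
  have : {n : ℕ | (n : ℤ) ≤ x} = ∅ := by
    ext n
    simp only [Set.mem_ofPred_eq, Set.mem_empty_iff_false, iff_false]
    omega
  simp [cdfZ, this]

lemma cdfZ_zero (μ : Measure ℕ) : cdfZ μ 0 = μ.real {0} := by
  have : {n : ℕ | (n : ℤ) ≤ 0} = {0} := by
    ext n
    simp
  rw [cdfZ, this]

lemma quantile_le_int_iff (μ : Measure ℕ) [IsProbabilityMeasure μ] {u : ℝ}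
    (hu : u ∈ Set.Ioo (0 : ℝ) 1) (x : ℤ) : (quantile μ u : ℤ) ≤ x ↔ u ≤ cdfZ μ x := by
  rcases lt_or_ge x 0 with hx | hx
  · rw [cdfZ_of_neg μ hx]
    constructor
    · intro h
      omega
    · intro h
      exact absurd hu.1 (not_lt.2 h)
  · lift x to ℕ using hx
    rw [Nat.cast_le, quantile_le_iff μ hu.2]

lemma lt_quantile_iff (μ : Measure ℕ) [IsProbabilityMeasure μ] {u : ℝ}
    (hu : u ∈ Set.Ioo (0 : ℝ) 1) (x : ℤ) : x < (quantile μ u : ℤ) ↔ cdfZ μ x < u := by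
  rw [← not_le, quantile_le_int_iff μ hu, not_le]

lemma quantile_pos_iff (μ : Measure ℕ) [IsProbabilityMeasure μ] {u : ℝ}
    (hu : u ∈ Set.Ioo (0 : ℝ) 1) : 0 < quantile μ u ↔ cdfZ μ 0 < u := by
  rw [← lt_quantile_iff μ hu]
  simp

lemma one_sub_mem {u : ℝ} (hu : u ∈ Set.Ioo (0 : ℝ) 1) : 1 - u ∈ Set.Ioo (0 : ℝ) 1 :=
  ⟨by linarith [hu.2], by linarith [hu.1]⟩

/-- The length of `{u ∈ (l, r) | u ≤ t}`. -/
def clip (l r t : ℝ) : ℝ := max (min t r - l) 0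

lemma volume_Ioo_inter_le (l r t : ℝ) :
    volume (Set.Ioo l r ∩ {u | u ≤ t}) = ENNReal.ofReal (clip l r t) := by
  have h : volume (Set.Ioo l r ∩ {u | u ≤ t}) = volume (Set.Ioo l (min t r)) := by
    apply le_antisymm
    · rw [Real.volume_Ioo, ← Real.volume_Ioc]
      exact measure_mono fun u hu => ⟨hu.1.1, le_min hu.2 hu.1.2.le⟩
    · refine measure_mono fun u hu => ⟨⟨hu.1, ?_⟩, ?_⟩
      · exact hu.2.trans_le (min_le_right _ _)
      · exact (hu.2.trans_le (min_le_left _ _)).le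
  rw [h, Real.volume_Ioo, clip, ENNReal.ofReal_max]
  simp

lemma volume_Ioo_inter_one_sub_le (l r t : ℝ) :
    volume (Set.Ioo l r ∩ {u | 1 - u ≤ t}) = ENNReal.ofReal (clip (1 - r) (1 - l) t) := by
  have h : volume (Set.Ioo l r ∩ {u | 1 - u ≤ t}) = volume (Set.Ioo (max l (1 - t)) r) := by
    apply le_antisymm
    · rw [Real.volume_Ioo, ← Real.volume_Ico]
      refine measure_mono fun u hu => ⟨max_le hu.1.1.le ?_, hu.1.2⟩
      have := hu.2
      simp only [Set.mem_ofPred_eq] at this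
      linarith
    · refine measure_mono fun u hu => ⟨⟨(le_max_left _ _).trans_lt hu.1, hu.2⟩, ?_⟩
      have := (le_max_right _ _).trans_lt hu.1
      simp only [Set.mem_ofPred_eq]
      linarith
  have h' : r - max l (1 - t) = min t (1 - l) - (1 - r) := by
    rcases le_total l (1 - t) with h | h
    · rw [max_eq_right h, min_eq_left (by linarith)]
      ring
    · rw [max_eq_left h, min_eq_right (by linarith)]
      ring
  rw [h, Real.volume_Ioo, clip, h', ENNReal.ofReal_max]
  simp

lemma clip_zero_one {t : ℝ} (h0 : 0 ≤ t) (h1 : t ≤ 1) :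
    clip 0 1 t = t := by
  rw [clip, min_eq_left h1, sub_zero, max_eq_left h0]

lemma volume_quantile_le (μ : Measure ℕ) [IsProbabilityMeasure μ] {l r : ℝ} (hl : 0 ≤ l)
    (hr : r ≤ 1) (x : ℤ) :
    volume (Set.Ioo l r ∩ {u | (quantile μ u : ℤ) ≤ x}) = ENNReal.ofReal (clip l r (cdfZ μ x)) := by
  rw [← volume_Ioo_inter_le]
  congr 1
  ext u
  refine and_congr_right fun hu => ?_
  exact quantile_le_int_iff μ ⟨hl.trans_lt hu.1, hu.2.trans_le hr⟩ x

lemma volume_quantile_one_sub_le (μ : Measure ℕ) [IsProbabilityMeasure μ] {l r : ℝ} (hl : 0 ≤ l)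
    (hr : r ≤ 1) (x : ℤ) :
    volume (Set.Ioo l r ∩ {u | (quantile μ (1 - u) : ℤ) ≤ x})
      = ENNReal.ofReal (clip (1 - r) (1 - l) (cdfZ μ x)) := by
  rw [← volume_Ioo_inter_one_sub_le]
  congr 1
  ext u
  refine and_congr_right fun hu => ?_
  exact quantile_le_int_iff μ (one_sub_mem ⟨hl.trans_lt hu.1, hu.2.trans_le hr⟩) x

lemma map_quantile_eq (μ : Measure ℕ) [IsProbabilityMeasure μ] :
    ((volume : Measure ℝ).restrict (Set.Ioo 0 1)).map (quantile μ) = μ := by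
  symm
  refine Measure.ext_of_Iic _ _ fun n => ?_
  rw [Measure.map_apply_of_aemeasurable (aemeasurable_quantile μ) measurableSet_Iic,
    Measure.restrict_apply' measurableSet_Ioo, Set.inter_comm]
  have h := volume_quantile_le μ le_rfl le_rfl (n : ℤ)
  simp only [Nat.cast_le] at h
  change _ = volume (Set.Ioo 0 1 ∩ {u | quantile μ u ≤ n})
  rw [h, clip_zero_one (cdfZ_nonneg _ _) (cdfZ_le_one _ _), cdfZ, ofReal_measureReal]
  simp only [Nat.cast_le]
  rfl

lemma map_quantile_one_sub_eq (μ : Measure ℕ) [IsProbabilityMeasure μ] :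
    ((volume : Measure ℝ).restrict (Set.Ioo 0 1)).map (fun u => quantile μ (1 - u)) = μ := by
  symm
  refine Measure.ext_of_Iic _ _ fun n => ?_
  rw [Measure.map_apply_of_aemeasurable (aemeasurable_quantile_sub μ) measurableSet_Iic,
    Measure.restrict_apply' measurableSet_Ioo, Set.inter_comm]
  have h := volume_quantile_one_sub_le μ le_rfl le_rfl (n : ℤ)
  simp only [Nat.cast_le] at h
  change _ = volume (Set.Ioo 0 1 ∩ {u | quantile μ (1 - u) ≤ n})
  rw [h, sub_self, sub_zero, clip_zero_one (cdfZ_nonneg _ _) (cdfZ_le_one _ _), cdfZ,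
    ofReal_measureReal]
  simp only [Nat.cast_le]
  rfl

section

variable (μ ν : Measure ℕ) [IsProbabilityMeasure μ] [IsProbabilityMeasure ν]

lemma aemeasurable_upper : AEMeasurable (fun u => (quantile μ u, quantile ν u))
    ((volume : Measure ℝ).restrict (Set.Ioo 0 1)) :=
  (aemeasurable_quantile μ).prodMk (aemeasurable_quantile ν)

lemma aemeasurable_lower : AEMeasurable (fun u => (quantile μ u, quantile ν (1 - u)))
    ((volume : Measure ℝ).restrict (Set.Ioo 0 1)) :=
  (aemeasurable_quantile μ).prodMk (aemeasurable_quantile_sub ν)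

lemma frechetUpper_fst : (frechetUpper μ ν).map Prod.fst = μ := by
  rw [frechetUpper, AEMeasurable.map_map_of_aemeasurable measurable_fst.aemeasurable
    (aemeasurable_upper μ ν)]
  exact map_quantile_eq μ

lemma frechetUpper_snd : (frechetUpper μ ν).map Prod.snd = ν := by
  rw [frechetUpper, AEMeasurable.map_map_of_aemeasurable measurable_snd.aemeasurable
    (aemeasurable_upper μ ν)]
  exact map_quantile_eq ν

lemma frechetLower_fst : (frechetLower μ ν).map Prod.fst = μ := by
  rw [frechetLower, AEMeasurable.map_map_of_aemeasurable measurable_fst.aemeasurable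
    (aemeasurable_lower μ ν)]
  exact map_quantile_eq μ

lemma frechetLower_snd : (frechetLower μ ν).map Prod.snd = ν := by
  rw [frechetLower, AEMeasurable.map_map_of_aemeasurable measurable_snd.aemeasurable
    (aemeasurable_lower μ ν)]
  exact map_quantile_one_sub_eq ν

instance isProbabilityMeasure_frechetUpper : IsProbabilityMeasure (frechetUpper μ ν) := by
  have : IsProbabilityMeasure ((frechetUpper μ ν).map Prod.fst) := by
    rw [frechetUpper_fst]
    infer_instance
  exact isProbabilityMeasure_of_map_fst

instance isProbabilityMeasure_frechetLower : IsProbabilityMeasure (frechetLower μ ν) := by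
  have : IsProbabilityMeasure ((frechetLower μ ν).map Prod.fst) := by
    rw [frechetLower_fst]
    infer_instance
  exact isProbabilityMeasure_of_map_fst

lemma comonotone_frechetUpper : Comonotone (frechetUpper μ ν) := by
  intro x y
  have key : ∀ p : ℕ × ℕ → Prop, (∀ u ∈ Set.Ioo (0 : ℝ) 1, ¬ p (quantile μ u, quantile ν u)) →
      frechetUpper μ ν {z | p z} = 0 := by
    intro p hp
    rw [frechetUpper, Measure.map_apply_of_aemeasurable (aemeasurable_upper μ ν)
      (Set.to_countable _).measurableSet, Measure.restrict_apply' measurableSet_Ioo]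
    convert measure_empty (μ := (volume : Measure ℝ))
    ext u
    simp only [Set.mem_inter_iff, Set.mem_preimage, Set.mem_ofPred_eq, Set.mem_empty_iff_false,
      iff_false, not_and]
    exact fun h hu => hp u hu h
  rcases le_total (cdfZ μ x) (cdfZ ν y) with h | h
  · refine Or.inl (key _ fun u hu => ?_)
    rw [quantile_le_int_iff μ hu, lt_quantile_iff ν hu]
    rintro ⟨h1, h2⟩
    linarith
  · refine Or.inr (key _ fun u hu => ?_)
    rw [quantile_le_int_iff ν hu, lt_quantile_iff μ hu]
    rintro ⟨h1, h2⟩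
    linarith

lemma countermonotone_frechetLower : Countermonotone (frechetLower μ ν) := by
  intro x y
  have key : ∀ p : ℕ × ℕ → Prop,
      (∀ᵐ u, u ∈ Set.Ioo (0 : ℝ) 1 → ¬ p (quantile μ u, quantile ν (1 - u))) →
      frechetLower μ ν {z | p z} = 0 := by
    intro p hp
    rw [frechetLower, Measure.map_apply_of_aemeasurable (aemeasurable_lower μ ν)
      (Set.to_countable _).measurableSet, Measure.restrict_apply' measurableSet_Ioo]
    refine measure_mono_null ?_ hp
    rintro u ⟨h, hu⟩ h'
    exact h' hu h
  rcases le_total (cdfZ μ x + cdfZ ν y) 1 with h | h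
  · refine Or.inl (key _ ?_)
    -- When `F x + G y = 1`, the level `u = F x` does satisfy both inequalities; it is discarded as
    -- a null set.
    filter_upwards [compl_mem_ae_iff.2 (measure_singleton (cdfZ μ x))] with u hx hu
    rw [quantile_le_int_iff μ hu, quantile_le_int_iff ν (one_sub_mem hu)]
    rintro ⟨h1, h2⟩
    exact hx (le_antisymm h1 (by linarith))
  · refine Or.inr (key _ ?_)
    filter_upwards with u hu
    rw [lt_quantile_iff μ hu, lt_quantile_iff ν (one_sub_mem hu)]
    rintro ⟨h1, h2⟩
    linarith

end

/-! ### Conditioning on positivity; extremal values as integrals over the level. -/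

lemma integral_map_unit {T : ℝ → ℕ × ℕ}
    (hT : AEMeasurable T ((volume : Measure ℝ).restrict (Set.Ioo 0 1))) (f : ℕ × ℕ → ℝ) :
    ∫ z, f z ∂(((volume : Measure ℝ).restrict (Set.Ioo 0 1)).map T) = ∫ u in 0..1, f (T u) := by
  rw [integral_map hT (measurable_of_countable _).aestronglyMeasurable,
    intervalIntegral.integral_of_le zero_le_one, integral_Ioc_eq_integral_Ioo]

lemma positivePart_map {T : ℝ → ℕ × ℕ}
    (hT : AEMeasurable T ((volume : Measure ℝ).restrict (Set.Ioo 0 1)))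
    {l r : ℝ} (hl : 0 ≤ l) (hr : r ≤ 1)
    (hS : ∀ u ∈ Set.Ioo (0 : ℝ) 1, (0 < (T u).1 ∧ 0 < (T u).2) ↔ l < u ∧ u < r) :
    positivePart (((volume : Measure ℝ).restrict (Set.Ioo 0 1)).map T)
      = (ENNReal.ofReal (r - l))⁻¹ • ((volume : Measure ℝ).restrict (Set.Ioo l r)).map T := by
  have hset : T ⁻¹' {z | 0 < z.1 ∧ 0 < z.2} ∩ Set.Ioo 0 1 = Set.Ioo l r := by
    ext u
    constructor
    · rintro ⟨h, hu⟩
      exact (hS u hu).1 h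
    · intro h
      have hu : u ∈ Set.Ioo (0 : ℝ) 1 := ⟨hl.trans_lt h.1, h.2.trans_le hr⟩
      exact ⟨(hS u hu).2 h, hu⟩
  have hm : MeasurableSet {z : ℕ × ℕ | 0 < z.1 ∧ 0 < z.2} := (Set.to_countable _).measurableSet
  rw [positivePart, ProbabilityTheory.cond, Measure.restrict_map_of_aemeasurable hT hm,
    Measure.map_apply_of_aemeasurable hT hm, Measure.restrict_apply' measurableSet_Ioo,
    Measure.restrict_restrict' measurableSet_Ioo, hset, Real.volume_Ioo]

/-- Conditioning amounts to normalised Lebesgue measure on `(l, r)`. Each of the two grades and the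
density contributes a factor `(r - l)⁻¹`, whence the cube. -/
lemma spearmanRho_positivePart_map {T : ℝ → ℕ × ℕ}
    (hT : AEMeasurable T ((volume : Measure ℝ).restrict (Set.Ioo 0 1)))
    {l r : ℝ} (hl : 0 ≤ l) (hlr : l < r) (hr : r ≤ 1)
    (hS : ∀ u ∈ Set.Ioo (0 : ℝ) 1, (0 < (T u).1 ∧ 0 < (T u).2) ↔ l < u ∧ u < r)
    {c₁ c₂ : ℤ → ℝ} (hc₁ : ∀ x, 0 ≤ c₁ x) (hc₂ : ∀ x, 0 ≤ c₂ x)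
    (h₁ : ∀ x : ℤ, volume (Set.Ioo l r ∩ {u | ((T u).1 : ℤ) ≤ x}) = ENNReal.ofReal (c₁ x))
    (h₂ : ∀ x : ℤ, volume (Set.Ioo l r ∩ {u | ((T u).2 : ℤ) ≤ x}) = ENNReal.ofReal (c₂ x)) :
    IsProbabilityMeasure (positivePart (((volume : Measure ℝ).restrict (Set.Ioo 0 1)).map T)) ∧
    (r - l) ^ 3
        * spearmanRho (positivePart (((volume : Measure ℝ).restrict (Set.Ioo 0 1)).map T))
      = 3 * ∫ u in l..r, (c₁ (T u).1 + c₁ ((T u).1 - 1) - (r - l))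
          * (c₂ (T u).2 + c₂ ((T u).2 - 1) - (r - l)) := by
  have hpos : 0 < r - l := sub_pos.2 hlr
  have hT' : AEMeasurable T ((volume : Measure ℝ).restrict (Set.Ioo l r)) :=
    hT.mono_set (Set.Ioo_subset_Ioo hl hr)
  set P := positivePart (((volume : Measure ℝ).restrict (Set.Ioo 0 1)).map T) with hP
  rw [positivePart_map hT hl hr hS] at hP
  have hprob : IsProbabilityMeasure P := by
    refine ⟨?_⟩
    rw [hP, Measure.smul_apply, Measure.map_apply_of_aemeasurable hT' MeasurableSet.univ,
      Set.preimage_univ, Measure.restrict_apply_univ, Real.volume_Ioo, smul_eq_mul]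
    exact ENNReal.inv_mul_cancel (by simpa using hlr) ENNReal.ofReal_ne_top
  refine ⟨hprob, ?_⟩
  have hreal : ∀ (p : ℕ × ℕ → Prop) (c : ℝ), 0 ≤ c →
      volume (Set.Ioo l r ∩ {u | p (T u)}) = ENNReal.ofReal c →
      P.real {z | p z} = (r - l)⁻¹ * c := by
    intro p c hc h
    rw [hP, measureReal_def, Measure.smul_apply,
      Measure.map_apply_of_aemeasurable hT' (Set.to_countable _).measurableSet,
      Measure.restrict_apply' measurableSet_Ioo, Set.inter_comm, Set.preimage_ofPred_eq, h,
      smul_eq_mul, ENNReal.toReal_mul, ENNReal.toReal_inv, ENNReal.toReal_ofReal hpos.le,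
      ENNReal.toReal_ofReal hc]
  have hg₁ : ∀ x : ℤ, (r - l) * grade (P.map Prod.fst) x = c₁ x + c₁ (x - 1) - (r - l) := by
    intro x
    rw [grade, cdfZ_map_fst, cdfZ_map_fst, hreal _ _ (hc₁ x) (h₁ x),
      hreal _ _ (hc₁ (x - 1)) (h₁ (x - 1))]
    field_simp
  have hg₂ : ∀ x : ℤ, (r - l) * grade (P.map Prod.snd) x = c₂ x + c₂ (x - 1) - (r - l) := by
    intro x
    rw [grade, cdfZ_map_snd, cdfZ_map_snd, hreal _ _ (hc₂ x) (h₂ x),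
      hreal _ _ (hc₂ (x - 1)) (h₂ (x - 1))]
    field_simp
  rw [spearmanRho_eq_integral]
  simp_rw [← hg₁, ← hg₂]
  generalize grade (P.map Prod.fst) = g₁
  generalize grade (P.map Prod.snd) = g₂
  rw [hP, integral_smul_measure, integral_map hT' (measurable_of_countable _).aestronglyMeasurable,
    intervalIntegral.integral_of_le hlr.le, integral_Ioc_eq_integral_Ioo, ENNReal.toReal_inv,
    ENNReal.toReal_ofReal hpos.le, smul_eq_mul]
  have : ∀ u, (r - l) * g₁ (T u).1 * ((r - l) * g₂ (T u).2)
      = (r - l) ^ 2 * (g₁ (T u).1 * g₂ (T u).2) := fun u => by ring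
  simp_rw [this]
  rw [integral_const_mul]
  field_simp

lemma clip_nonneg (l r t : ℝ) : 0 ≤ clip l r t := le_max_right _ _

section

variable (μ ν : Measure ℕ) [IsProbabilityMeasure μ] [IsProbabilityMeasure ν]

lemma isGreatest_upper : IsGreatest (rhoRange μ ν)
    (3 * ∫ u in 0..1, grade μ (quantile μ u) * grade ν (quantile ν u)) := by
  have h := (comonotone_frechetUpper μ ν).isGreatest
  rw [spearmanRho_eq_integral, frechetUpper_fst, frechetUpper_snd] at h
  have h' := integral_map_unit (aemeasurable_upper μ ν) (fun z => grade μ z.1 * grade ν z.2)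
  rw [← frechetUpper] at h'
  rwa [h'] at h

lemma isLeast_lower : IsLeast (rhoRange μ ν)
    (3 * ∫ u in 0..1, grade μ (quantile μ u) * grade ν (quantile ν (1 - u))) := by
  have h := (countermonotone_frechetLower μ ν).isLeast
  rw [spearmanRho_eq_integral, frechetLower_fst, frechetLower_snd] at h
  have h' := integral_map_unit (aemeasurable_lower μ ν) (fun z => grade μ z.1 * grade ν z.2)
  rw [← frechetLower] at h'
  rwa [h'] at h

/-- Both quantiles are positive exactly when `u > m`, and the conditioned law is still comonotone,
so it attains the supremum for its own margins. -/
lemma rhoPosMax_eq {m : ℝ} (hm : m = max (cdfZ μ 0) (cdfZ ν 0)) (hm1 : m < 1) :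
    (1 - m) ^ 3 * rhoPosMax μ ν = 3 * ∫ u in m..1,
      (clip m 1 (cdfZ μ (quantile μ u)) + clip m 1 (cdfZ μ ((quantile μ u : ℤ) - 1)) - (1 - m))
      * (clip m 1 (cdfZ ν (quantile ν u)) + clip m 1 (cdfZ ν ((quantile ν u : ℤ) - 1))
        - (1 - m)) := by
  have hm0 : 0 ≤ m := by
    rw [hm]
    exact (cdfZ_nonneg μ 0).trans (le_max_left _ _)
  obtain ⟨hP, h⟩ := spearmanRho_positivePart_map (aemeasurable_upper μ ν) hm0 hm1 le_rfl
    (fun u hu => by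
      rw [quantile_pos_iff μ hu, quantile_pos_iff ν hu, hm, max_lt_iff]
      exact (and_iff_left hu.2).symm)
    (c₁ := fun x => clip m 1 (cdfZ μ x)) (c₂ := fun x => clip m 1 (cdfZ ν x))
    (fun x => clip_nonneg _ _ _) (fun x => clip_nonneg _ _ _)
    (volume_quantile_le μ hm0 le_rfl) (volume_quantile_le ν hm0 le_rfl)
  rw [← h, ← frechetUpper, rhoPosMax]
  rw [← frechetUpper] at hP
  rw [((comonotone_frechetUpper μ ν).of_absolutelyContinuous
    ProbabilityTheory.cond_absolutelyContinuous).isGreatest (π := positivePart _) |>.csSup_eq]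

lemma rhoPosMin_eq {p₁ p₂ : ℝ} (hp₁ : p₁ = cdfZ μ 0) (hp₂ : p₂ = cdfZ ν 0) (hp : p₁ < 1 - p₂) :
    (1 - p₂ - p₁) ^ 3 * rhoPosMin μ ν = 3 * ∫ u in p₁..(1 - p₂),
      (clip p₁ (1 - p₂) (cdfZ μ (quantile μ u))
        + clip p₁ (1 - p₂) (cdfZ μ ((quantile μ u : ℤ) - 1)) - (1 - p₂ - p₁))
      * (clip p₂ (1 - p₁) (cdfZ ν (quantile ν (1 - u)))
        + clip p₂ (1 - p₁) (cdfZ ν ((quantile ν (1 - u) : ℤ) - 1)) - (1 - p₂ - p₁)) := by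
  have h1 : 0 ≤ p₁ := hp₁ ▸ cdfZ_nonneg μ 0
  have h2 : 1 - p₂ ≤ 1 := by linarith [hp₂ ▸ cdfZ_nonneg ν 0]
  obtain ⟨hP, h⟩ := spearmanRho_positivePart_map (aemeasurable_lower μ ν) h1 hp h2
    (fun u hu => by
      rw [quantile_pos_iff μ hu, quantile_pos_iff ν (one_sub_mem hu), ← hp₁, ← hp₂]
      exact and_congr_right fun _ => ⟨fun h => by linarith, fun h => by linarith⟩)
    (c₁ := fun x => clip p₁ (1 - p₂) (cdfZ μ x)) (c₂ := fun x => clip p₂ (1 - p₁) (cdfZ ν x))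
    (fun x => clip_nonneg _ _ _) (fun x => clip_nonneg _ _ _)
    (volume_quantile_le μ h1 h2)
    (by simpa only [sub_sub_cancel] using volume_quantile_one_sub_le ν h1 h2)
  rw [← h, ← frechetLower, rhoPosMin]
  rw [← frechetLower] at hP
  rw [((countermonotone_frechetLower μ ν).of_absolutelyContinuous
    ProbabilityTheory.cond_absolutelyContinuous).isLeast (π := positivePart _) |>.csInf_eq]

end

/-! ### Scores and their primitives. -/

/-- The grade of the quantile. -/
def score (μ : Measure ℕ) (u : ℝ) : ℝ := grade μ (quantile μ u)

lemma intervalIntegrable_comp {T : ℝ → ℕ × ℕ}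
    (hT : AEMeasurable T ((volume : Measure ℝ).restrict (Set.Ioo 0 1))) {f : ℕ × ℕ → ℝ} {C : ℝ}
    (hf : ∀ z, |f z| ≤ C) {a b : ℝ} (ha : a ∈ Set.Icc (0 : ℝ) 1) (hb : b ∈ Set.Icc (0 : ℝ) 1) :
    IntervalIntegrable (fun u => f (T u)) volume a b := by
  have h : IntegrableOn (fun u => f (T u)) (Set.Ioc 0 1) volume := by
    rw [integrableOn_Ioc_iff_integrableOn_Ioo]
    exact Integrable.of_bound
      ((measurable_of_countable f).comp_aemeasurable hT).aestronglyMeasurable C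
      (Filter.Eventually.of_forall fun u => hf (T u))
  rw [intervalIntegrable_iff]
  refine h.mono_set ?_
  exact Set.Ioc_subset_Ioc (le_min ha.1 hb.1) (max_le ha.2 hb.2)

lemma cdfZ_mem (μ : Measure ℕ) [IsProbabilityMeasure μ] (x : ℤ) :
    cdfZ μ x ∈ Set.Icc (0 : ℝ) 1 := ⟨cdfZ_nonneg μ x, cdfZ_le_one μ x⟩

lemma one_sub_mem_Icc {u : ℝ} (hu : u ∈ Set.Icc (0 : ℝ) 1) : 1 - u ∈ Set.Icc (0 : ℝ) 1 :=
  ⟨by linarith [hu.2], by linarith [hu.1]⟩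

lemma abs_grade_mul_grade_le (μ ν : Measure ℕ) [IsProbabilityMeasure μ] [IsProbabilityMeasure ν]
    (z : ℕ × ℕ) : |grade μ z.1 * grade ν z.2| ≤ 1 := by
  rw [abs_mul]
  exact mul_le_one₀ (abs_grade_le μ _) (abs_nonneg _) (abs_grade_le ν _)

section

variable (μ ν : Measure ℕ) [IsProbabilityMeasure μ] [IsProbabilityMeasure ν] {a b : ℝ}

lemma intervalIntegrable_score (ha : a ∈ Set.Icc (0 : ℝ) 1) (hb : b ∈ Set.Icc (0 : ℝ) 1) :
    IntervalIntegrable (score μ) volume a b :=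
  intervalIntegrable_comp (aemeasurable_upper μ μ) (f := fun z => grade μ z.1)
    (fun _ => abs_grade_le μ _) ha hb

lemma intervalIntegrable_score_one_sub (ha : a ∈ Set.Icc (0 : ℝ) 1)
    (hb : b ∈ Set.Icc (0 : ℝ) 1) :
    IntervalIntegrable (fun u => score μ (1 - u)) volume a b :=
  intervalIntegrable_comp (aemeasurable_lower μ μ) (f := fun z => grade μ z.2)
    (fun _ => abs_grade_le μ _) ha hb

lemma intervalIntegrable_score_mul (ha : a ∈ Set.Icc (0 : ℝ) 1) (hb : b ∈ Set.Icc (0 : ℝ) 1) :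
    IntervalIntegrable (fun u => score μ u * score ν u) volume a b :=
  intervalIntegrable_comp (aemeasurable_upper μ ν) (f := fun z => grade μ z.1 * grade ν z.2)
    (abs_grade_mul_grade_le μ ν) ha hb

lemma intervalIntegrable_score_mul_one_sub (ha : a ∈ Set.Icc (0 : ℝ) 1)
    (hb : b ∈ Set.Icc (0 : ℝ) 1) :
    IntervalIntegrable (fun u => score μ u * score ν (1 - u)) volume a b :=
  intervalIntegrable_comp (aemeasurable_lower μ ν) (f := fun z => grade μ z.1 * grade ν z.2)
    (abs_grade_mul_grade_le μ ν) ha hb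

lemma quantile_eq_of_mem {u : ℝ} (hu : u ∈ Set.Ioo (0 : ℝ) 1) {x : ℤ} (h₁ : cdfZ μ (x - 1) < u)
    (h₂ : u ≤ cdfZ μ x) : (quantile μ u : ℤ) = x := by
  rw [← quantile_le_int_iff μ hu] at h₂
  rw [← lt_quantile_iff μ hu] at h₁
  omega

lemma score_eq_of_mem {u : ℝ} (hu : u ∈ Set.Ioo (0 : ℝ) 1) {x : ℤ} (h₁ : cdfZ μ (x - 1) < u)
    (h₂ : u ≤ cdfZ μ x) : score μ u = cdfZ μ x + cdfZ μ (x - 1) - 1 := by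
  rw [score, quantile_eq_of_mem μ hu h₁ h₂, grade]

lemma score_of_le_zero {u : ℝ} (hu : u ∈ Set.Ioo (0 : ℝ) 1) (h : u ≤ cdfZ μ 0) :
    score μ u = cdfZ μ 0 - 1 := by
  have h0 := cdfZ_of_neg μ (by norm_num : (0 : ℤ) - 1 < 0)
  rw [score_eq_of_mem μ hu (x := 0) (by rw [h0]; exact hu.1) h, h0, add_zero]

lemma integral_score_step {x : ℤ} (ha : cdfZ μ (x - 1) ≤ a) (hab : a ≤ b) (hb : b ≤ cdfZ μ x) :
    ∫ u in a..b, score μ u = (b - a) * (cdfZ μ x + cdfZ μ (x - 1) - 1) := by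
  have h : Set.EqOn (score μ) (fun _ => cdfZ μ x + cdfZ μ (x - 1) - 1) (Set.uIoo a b) := by
    intro u hu
    rw [Set.uIoo_of_le hab] at hu
    exact score_eq_of_mem μ ⟨((cdfZ_nonneg μ _).trans ha).trans_lt hu.1,
      hu.2.trans_le (hb.trans (cdfZ_le_one μ _))⟩ (ha.trans_lt hu.1) (hu.2.le.trans hb)
  rw [intervalIntegral.integral_congr_uIoo h, intervalIntegral.integral_const, smul_eq_mul]

/-- On each step the length times the value is `(b - a) * (b + a - 1)`, the increment of `t ^ 2 -
t`, so the sum telescopes. -/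
lemma integral_score_cdfZ (n : ℕ) :
    ∫ u in 0..cdfZ μ ((n : ℤ) - 1), score μ u
      = cdfZ μ ((n : ℤ) - 1) ^ 2 - cdfZ μ ((n : ℤ) - 1) := by
  induction n with
  | zero => simp [cdfZ_of_neg μ (by norm_num : (-1 : ℤ) < 0)]
  | succ n ih =>
    have h1 : ((n + 1 : ℕ) : ℤ) - 1 = n := by push_cast; ring
    rw [h1, ← intervalIntegral.integral_add_adjacent_intervals
      (intervalIntegrable_score μ (Set.left_mem_Icc.2 zero_le_one) (cdfZ_mem μ ((n : ℤ) - 1)))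
      (intervalIntegrable_score μ (cdfZ_mem μ _) (cdfZ_mem μ _)), ih,
      integral_score_step μ le_rfl (cdfZ_mono μ (by omega)) le_rfl]
    ring

lemma integral_score {n : ℕ} {v : ℝ} (h₁ : cdfZ μ ((n : ℤ) - 1) ≤ v) (h₂ : v ≤ cdfZ μ n) :
    ∫ u in 0..v, score μ u = cdfZ μ ((n : ℤ) - 1) ^ 2 - cdfZ μ ((n : ℤ) - 1)
      + (v - cdfZ μ ((n : ℤ) - 1)) * (cdfZ μ n + cdfZ μ ((n : ℤ) - 1) - 1) := by
  rw [← intervalIntegral.integral_add_adjacent_intervals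
      (intervalIntegrable_score μ (Set.left_mem_Icc.2 zero_le_one) (cdfZ_mem μ ((n : ℤ) - 1)))
      (intervalIntegrable_score μ (cdfZ_mem μ _)
        ⟨(cdfZ_nonneg μ _).trans h₁, h₂.trans (cdfZ_le_one μ _)⟩),
      integral_score_cdfZ, integral_score_step μ le_rfl h₁ h₂]

lemma integral_score_zero : ∫ u in 0..cdfZ μ 0, score μ u = cdfZ μ 0 ^ 2 - cdfZ μ 0 := by
  have h0 := cdfZ_of_neg μ (by norm_num : (0 : ℤ) - 1 < 0)
  rw [integral_score_step μ (x := 0) h0.le (cdfZ_nonneg μ 0) le_rfl, h0]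
  ring

/-- The telescoping formula does not suffice, since `F` need not reach `1` at a finite point;
centring of the grade is used instead. -/
lemma integral_score_one : ∫ u in 0..1, score μ u = 0 := by
  have h := integral_map_unit (aemeasurable_upper μ μ) (fun z => grade μ z.1)
  rw [← frechetUpper, ← integral_map (f := fun n : ℕ => grade μ n) measurable_fst.aemeasurable
    (measurable_of_countable _).aestronglyMeasurable, frechetUpper_fst, integral_grade] at h
  exact h.symm

lemma integral_score_sub (ha : a ∈ Set.Icc (0 : ℝ) 1) (hb : b ∈ Set.Icc (0 : ℝ) 1) :
    ∫ u in a..b, score μ u = (∫ u in 0..b, score μ u) - ∫ u in 0..a, score μ u := by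
  have h0 : (0 : ℝ) ∈ Set.Icc (0 : ℝ) 1 := Set.left_mem_Icc.2 zero_le_one
  exact (intervalIntegral.integral_interval_sub_left (intervalIntegrable_score μ h0 hb)
    (intervalIntegrable_score μ h0 ha)).symm

lemma integral_score_one_sub (ha : a ∈ Set.Icc (0 : ℝ) 1) (hb : b ∈ Set.Icc (0 : ℝ) 1) :
    ∫ u in a..b, score μ (1 - u)
      = (∫ u in 0..(1 - a), score μ u) - ∫ u in 0..(1 - b), score μ u := by
  rw [intervalIntegral.integral_comp_sub_left (score μ) 1,
    integral_score_sub μ (one_sub_mem_Icc hb) (one_sub_mem_Icc ha)]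

end

/-! ### Truncated scores and the upper bound. -/

/-- Integral of a product of two functions, each shifted by a constant on an end interval. -/
lemma integral_mul_shift {f P Q : ℝ → ℝ} {a b x y k l : ℝ} (hx : x ∈ Set.Icc a b)
    (hy : y ∈ Set.Icc a b) (hP : IntervalIntegrable P volume a b)
    (hQ : IntervalIntegrable Q volume a b)
    (hPQ : IntervalIntegrable (fun u => P u * Q u) volume a b)
    (hf : ∀ u ∈ Set.Ioo a b, u ≠ y →
      f u = (P u + if x < u then k else 0) * (Q u + if u < y then l else 0)) :
    ∫ u in a..b, f u = (∫ u in a..b, P u * Q u) + k * (∫ u in x..b, Q u)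
      + l * (∫ u in a..y, P u) + k * l * max (y - x) 0 := by
  have hab : a ≤ b := hx.1.trans hx.2
  -- The two shifts act together only on the overlap `(x, y)`, which is empty when `y ≤ x`; this
  -- produces the `max`.
  have hf' : ∀ᵐ u, u ∈ Set.Ioo a b → f u = P u * Q u + k * (Set.Ioi x).indicator Q u
      + l * (Set.Iio y).indicator P u + (Set.Ioo x y).indicator (fun _ => k * l) u := by
    filter_upwards [compl_mem_ae_iff.2 (measure_singleton y)] with u huy hu
    rw [hf u hu huy]
    simp only [Set.indicator_apply, Set.mem_Ioi, Set.mem_Iio, Set.mem_Ioo]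
    split_ifs <;> first | (exfalso; tauto) | ring
  have conv : ∀ (g : ℝ → ℝ) {c d : ℝ}, c ≤ d → ∫ u in c..d, g u = ∫ u in Set.Ioo c d, g u :=
    fun g c d h => by rw [intervalIntegral.integral_of_le h, integral_Ioc_eq_integral_Ioo]
  have toOn : ∀ {g : ℝ → ℝ}, IntervalIntegrable g volume a b → IntegrableOn g (Set.Ioo a b) :=
    fun h => (intervalIntegrable_iff_integrableOn_Ioo_of_le hab).1 h
  have e₁ : Set.Ioo a b ∩ Set.Ioi x = Set.Ioo x b := by
    ext u
    exact ⟨fun h => ⟨h.2, h.1.2⟩, fun h => ⟨⟨hx.1.trans_lt h.1, h.2⟩, h.1⟩⟩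
  have e₂ : Set.Ioo a b ∩ Set.Iio y = Set.Ioo a y := by
    ext u
    exact ⟨fun h => ⟨h.1.1, h.2⟩, fun h => ⟨⟨h.1, h.2.trans_le hy.2⟩, h.2⟩⟩
  have e₃ : Set.Ioo a b ∩ Set.Ioo x y = Set.Ioo x y :=
    Set.inter_eq_right.2 (Set.Ioo_subset_Ioo hx.1 hy.2)
  have i₁ := ((toOn hQ).indicator (measurableSet_Ioi (a := x))).const_mul k
  have i₂ := ((toOn hP).indicator (measurableSet_Iio (a := y))).const_mul l
  have i₃ : IntegrableOn ((Set.Ioo x y).indicator (fun _ => k * l)) (Set.Ioo a b) :=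
    IntegrableOn.indicator (integrableOn_const measure_Ioo_lt_top.ne) measurableSet_Ioo
  have i₄ : IntegrableOn (fun u => P u * Q u + k * (Set.Ioi x).indicator Q u) (Set.Ioo a b) :=
    (toOn hPQ).add i₁
  have i₅ : IntegrableOn (fun u => P u * Q u + k * (Set.Ioi x).indicator Q u
      + l * (Set.Iio y).indicator P u) (Set.Ioo a b) := i₄.add i₂
  rw [conv _ hab, conv _ hab, conv _ hx.2, conv _ hy.1,
    setIntegral_congr_ae measurableSet_Ioo hf', integral_add i₅ i₃,
    integral_add i₄ i₂, integral_add (toOn hPQ) i₁, integral_const_mul,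
    integral_const_mul, setIntegral_indicator measurableSet_Ioi,
    setIntegral_indicator measurableSet_Iio, setIntegral_indicator measurableSet_Ioo, e₁, e₂, e₃,
    setIntegral_const, smul_eq_mul, Real.volume_real_Ioo]
  ring

section

variable (μ ν : Measure ℕ) [IsProbabilityMeasure μ] [IsProbabilityMeasure ν]

lemma clip_of_le {l r t : ℝ} (h : t ≤ l) : clip l r t = 0 := by
  rw [clip, max_eq_right]
  linarith [min_le_left t r]

lemma clip_of_mem {l r t : ℝ} (h₁ : l ≤ t) (h₂ : t ≤ r) : clip l r t = t - l := by
  rw [clip, min_eq_left h₂, max_eq_left (sub_nonneg.2 h₁)]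

lemma clip_of_ge {l r t : ℝ} (h₁ : l ≤ r) (h₂ : r ≤ t) : clip l r t = r - l := by
  rw [clip, min_eq_right h₂, max_eq_left (sub_nonneg.2 h₁)]

/-- Above the atom `s` both values of `F` lose `m`. At `s` itself `F (s - 1)` lies below `m` and is
clipped to `0`, leaving the surplus `m - F (s - 1)`. At `u = F s` the quantile is still `s`, so that
level is excluded. -/
lemma clip_add_clip_eq_score {m u : ℝ} {s : ℤ} (hs : cdfZ μ (s - 1) ≤ m)
    (hs' : m < cdfZ μ s) (hu : u ∈ Set.Ioo (0 : ℝ) 1) (hmu : m < u) (hus : u ≠ cdfZ μ s) :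
    clip m 1 (cdfZ μ (quantile μ u)) + clip m 1 (cdfZ μ ((quantile μ u : ℤ) - 1)) - (1 - m)
      = score μ u - m + if u < cdfZ μ s then m - cdfZ μ (s - 1) else 0 := by
  rw [score]
  split_ifs with h
  · rw [quantile_eq_of_mem μ hu (hs.trans_lt hmu) h.le, clip_of_mem hs'.le (cdfZ_le_one μ _),
      clip_of_le hs, grade]
    ring
  · have h' : s < quantile μ u := (lt_quantile_iff μ hu s).2 (lt_of_le_of_ne (not_lt.1 h) hus.symm)
    have h1 : m ≤ cdfZ μ ((quantile μ u : ℤ) - 1) := hs'.le.trans (cdfZ_mono μ (by omega))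
    rw [clip_of_mem (h1.trans (cdfZ_mono μ (by omega))) (cdfZ_le_one μ _),
      clip_of_mem h1 (cdfZ_le_one μ _), grade]
    ring

lemma clip_add_clip_eq_score_zero {u : ℝ} (hu : u ∈ Set.Ioo (0 : ℝ) 1) (hmu : cdfZ μ 0 < u) :
    clip (cdfZ μ 0) 1 (cdfZ μ (quantile μ u)) + clip (cdfZ μ 0) 1 (cdfZ μ ((quantile μ u : ℤ) - 1))
      - (1 - cdfZ μ 0) = score μ u - cdfZ μ 0 := by
  have h' : 0 < (quantile μ u : ℤ) := (lt_quantile_iff μ hu 0).2 hmu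
  rw [score, clip_of_mem (cdfZ_mono μ (by omega)) (cdfZ_le_one μ _),
    clip_of_mem (cdfZ_mono μ (by omega)) (cdfZ_le_one μ _), grade]
  ring

/-- The pair `g`, `g'` stands for the values of `G` around the level `F s`. Only the primitive
formula `hg` is needed, so the case where no crossing point exists is covered by `g = g' = 1`. -/
lemma integral_upper {m : ℝ} (hm : m = cdfZ ν 0) {s : ℕ} (hs : cdfZ μ ((s : ℤ) - 1) ≤ m)
    (hs' : m < cdfZ μ s) {g g' : ℝ} (hg : ∫ u in 0..cdfZ μ s, score ν u
      = g' ^ 2 - g' + (cdfZ μ s - g') * (g + g' - 1)) :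
    3 * ∫ u in 0..1, score ν u * score μ u
      = 3 * (∫ u in m..1,
        (clip m 1 (cdfZ ν (quantile ν u)) + clip m 1 (cdfZ ν ((quantile ν u : ℤ) - 1)) - (1 - m))
        * (clip m 1 (cdfZ μ (quantile μ u)) + clip m 1 (cdfZ μ ((quantile μ u : ℤ) - 1))
          - (1 - m)))
        + 3 * m * (1 - m)
        + 3 * (m - cdfZ μ ((s : ℤ) - 1)) * (cdfZ μ s * (m - g - g') + g * g') := by
  have h0 : (0 : ℝ) ∈ Set.Icc (0 : ℝ) 1 := Set.left_mem_Icc.2 zero_le_one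
  have h1 : (1 : ℝ) ∈ Set.Icc (0 : ℝ) 1 := Set.right_mem_Icc.2 zero_le_one
  have hm' : m ∈ Set.Icc (0 : ℝ) 1 := hm ▸ cdfZ_mem ν 0
  have hF := cdfZ_mem μ s
  have hm1 : m < 1 := hs'.trans_le hF.2
  have iμ := intervalIntegrable_score μ hm' h1
  have iν := intervalIntegrable_score ν hm' h1
  have iνF := intervalIntegrable_score ν hm' hF
  have ic : ∀ c a b : ℝ, IntervalIntegrable (fun _ => c) volume a b := fun c a b =>
    intervalIntegrable_const
  have iνμ := intervalIntegrable_score_mul ν μ hm' h1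
  have expand : ∀ u, (score ν u - m) * (score μ u - m)
      = score ν u * score μ u - m * score ν u - m * score μ u + m ^ 2 := fun u => by ring
  have iall : IntervalIntegrable (fun u => (score ν u - m) * (score μ u - m)) volume m 1 := by
    simp_rw [expand]
    exact ((iνμ.sub (iν.const_mul m)).sub (iμ.const_mul m)).add (ic _ _ _)
  -- `k = 0`: the level `m` is a value of `G`, so truncation cuts no atom of `ν`.
  have hJ := integral_mul_shift (P := fun u => score ν u - m) (Q := fun u => score μ u - m)
    (x := m) (y := cdfZ μ s) (k := 0) (l := m - cdfZ μ ((s : ℤ) - 1))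
    (f := fun u =>
      (clip m 1 (cdfZ ν (quantile ν u)) + clip m 1 (cdfZ ν ((quantile ν u : ℤ) - 1)) - (1 - m))
        * (clip m 1 (cdfZ μ (quantile μ u)) + clip m 1 (cdfZ μ ((quantile μ u : ℤ) - 1))
          - (1 - m)))
    (Set.left_mem_Icc.2 hm1.le) ⟨hs'.le, hF.2⟩ (iν.sub (ic _ _ _)) (iμ.sub (ic _ _ _)) iall
    (fun u hu hus => by
      have hu' : u ∈ Set.Ioo (0 : ℝ) 1 := ⟨hm'.1.trans_lt hu.1, hu.2⟩
      rw [clip_add_clip_eq_score μ hs hs' hu' hu.1 hus, hm,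
        clip_add_clip_eq_score_zero ν hu' (hm ▸ hu.1)]
      simp)
  have hE : ∫ u in m..1, (score ν u - m) * (score μ u - m)
      = (∫ u in m..1, score ν u * score μ u) - m * (∫ u in m..1, score ν u)
        - m * (∫ u in m..1, score μ u) + m ^ 2 * (1 - m) := by
    simp_rw [expand]
    rw [intervalIntegral.integral_add ((iνμ.sub (iν.const_mul m)).sub (iμ.const_mul m)) (ic _ _ _),
      intervalIntegral.integral_sub (iνμ.sub (iν.const_mul m)) (iμ.const_mul m),
      intervalIntegral.integral_sub iνμ (iν.const_mul m), intervalIntegral.integral_const_mul,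
      intervalIntegral.integral_const_mul, intervalIntegral.integral_const, smul_eq_mul]
    ring
  have hB : ∫ u in m..cdfZ μ s, (score ν u - m)
      = (∫ u in m..cdfZ μ s, score ν u) - m * (cdfZ μ s - m) := by
    rw [intervalIntegral.integral_sub iνF (ic _ _ _), intervalIntegral.integral_const, smul_eq_mul]
    ring
  have h₀ : ∫ u in 0..m, score ν u * score μ u = (m - 1) * ∫ u in 0..m, score μ u := by
    rw [← intervalIntegral.integral_const_mul]
    refine intervalIntegral.integral_congr_uIoo fun u hu => ?_
    rw [Set.uIoo_of_le hm'.1] at hu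
    rw [score_of_le_zero ν ⟨hu.1, hu.2.trans hm1⟩ (hm ▸ hu.2.le), hm]
  have hsplit := intervalIntegral.integral_add_adjacent_intervals
    (intervalIntegrable_score_mul ν μ h0 hm') iνμ
  have a₁ := integral_score_sub μ hm' h1
  have a₂ := integral_score μ hs hs'.le
  have b₁ := integral_score_sub ν hm' h1
  have b₂ := integral_score_sub ν hm' hF
  have b₃ := integral_score_zero ν
  rw [← hm] at b₃
  rw [integral_score_one] at a₁ b₁
  rw [hJ, hE, hB, ← hsplit, h₀, a₁, b₁, b₂, hg, a₂, b₃]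
  ring

/-! ### Two-sided truncation and the lower bound. -/

lemma clip_add_clip_eq_score_of_lt {p₁ p₂ u : ℝ} {s : ℤ} (hp₁ : p₁ = cdfZ μ 0)
    (hs : cdfZ μ (s - 1) ≤ 1 - p₂) (hs' : 1 - p₂ < cdfZ μ s) (hp : p₁ < 1 - p₂)
    (hu : u ∈ Set.Ioo (0 : ℝ) 1) (hpu : p₁ < u)
    (hup : u < 1 - p₂) :
    clip p₁ (1 - p₂) (cdfZ μ (quantile μ u))
        + clip p₁ (1 - p₂) (cdfZ μ ((quantile μ u : ℤ) - 1)) - (1 - p₂ - p₁)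
      = score μ u + (p₂ - p₁) + if cdfZ μ (s - 1) < u then 1 - cdfZ μ s - p₂ else 0 := by
  have hpos : 0 < (quantile μ u : ℤ) := (lt_quantile_iff μ hu 0).2 (hp₁ ▸ hpu)
  have hlow : p₁ ≤ cdfZ μ ((quantile μ u : ℤ) - 1) := hp₁ ▸ cdfZ_mono μ (by omega)
  rw [score]
  split_ifs with h
  · rw [quantile_eq_of_mem μ hu h (hup.trans hs').le] at hlow ⊢
    rw [clip_of_ge hp.le hs'.le, clip_of_mem hlow hs, grade]
    ring
  · have h' : (quantile μ u : ℤ) ≤ s - 1 := (quantile_le_int_iff μ hu _).2 (not_lt.1 h)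
    have h1 : cdfZ μ (quantile μ u) ≤ 1 - p₂ := (cdfZ_mono μ h').trans hs
    rw [clip_of_mem (hlow.trans (cdfZ_mono μ (by omega))) h1,
      clip_of_mem hlow ((cdfZ_mono μ (by omega)).trans h1), grade]
    ring

lemma cdfZ_zero_le_pred {s : ℕ} {c : ℝ} (h : cdfZ μ 0 < c) (hs : c < cdfZ μ s) :
    cdfZ μ 0 ≤ cdfZ μ ((s : ℤ) - 1) := by
  rcases Nat.eq_zero_or_pos s with rfl | h'
  · exact absurd (h.trans hs) (by simp)
  · exact cdfZ_mono μ (by omega)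

/-- The unit interval splits at `p₁` and `1 - p₂`. On the outer pieces one coordinate is zero and
its score constant; the middle piece is the positive part. There only the upper truncation can cut
an atom, as the lower level of each margin is its own mass at zero. -/
lemma integral_lower {p₁ p₂ : ℝ} (hp₁ : p₁ = cdfZ μ 0) (hp₂ : p₂ = cdfZ ν 0) (hp : p₁ + p₂ < 1)
    {s t : ℕ} (hs : cdfZ μ ((s : ℤ) - 1) ≤ 1 - p₂) (hs' : 1 - p₂ < cdfZ μ s)
    (ht : cdfZ ν ((t : ℤ) - 1) ≤ 1 - p₁) (ht' : 1 - p₁ < cdfZ ν t) :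
    ∫ u in 0..1, score μ u * score ν (1 - u) =
      (∫ u in p₁..(1 - p₂),
        (clip p₁ (1 - p₂) (cdfZ μ (quantile μ u))
          + clip p₁ (1 - p₂) (cdfZ μ ((quantile μ u : ℤ) - 1)) - (1 - p₂ - p₁))
        * (clip p₂ (1 - p₁) (cdfZ ν (quantile ν (1 - u)))
          + clip p₂ (1 - p₁) (cdfZ ν ((quantile ν (1 - u) : ℤ) - 1)) - (1 - p₂ - p₁)))
      + (1 - p₁) * (∫ u in 0..(1 - p₁), score ν u) + (1 - p₂) * (∫ u in 0..(1 - p₂), score μ u)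
      + (p₂ - p₁) * ((∫ u in 0..(1 - p₂), score μ u) - (p₁ ^ 2 - p₁))
      - (p₂ - p₁) * ((∫ u in 0..(1 - p₁), score ν u) - (p₂ ^ 2 - p₂))
      + (p₂ - p₁) ^ 2 * (1 - p₂ - p₁)
      - (1 - cdfZ μ s - p₂) * ((∫ u in 0..(1 - cdfZ μ ((s : ℤ) - 1)), score ν u) - (p₂ ^ 2 - p₂)
          - (p₂ - p₁) * (1 - p₂ - cdfZ μ ((s : ℤ) - 1)))
      - (1 - cdfZ ν t - p₁) * ((∫ u in 0..(1 - cdfZ ν ((t : ℤ) - 1)), score μ u) - (p₁ ^ 2 - p₁)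
          + (p₂ - p₁) * (1 - cdfZ ν ((t : ℤ) - 1) - p₁))
      - (1 - cdfZ μ s - p₂) * (1 - cdfZ ν t - p₁)
          * max (1 - cdfZ ν ((t : ℤ) - 1) - cdfZ μ ((s : ℤ) - 1)) 0 := by
  have h0 : (0 : ℝ) ∈ Set.Icc (0 : ℝ) 1 := Set.left_mem_Icc.2 zero_le_one
  have h1 : (1 : ℝ) ∈ Set.Icc (0 : ℝ) 1 := Set.right_mem_Icc.2 zero_le_one
  have hm₁ : p₁ ∈ Set.Icc (0 : ℝ) 1 := hp₁ ▸ cdfZ_mem μ 0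
  have hm₂ : p₂ ∈ Set.Icc (0 : ℝ) 1 := hp₂ ▸ cdfZ_mem ν 0
  have hc := one_sub_mem_Icc hm₂
  have hF := cdfZ_mem μ ((s : ℤ) - 1)
  have hG := one_sub_mem_Icc (cdfZ_mem ν ((t : ℤ) - 1))
  have hpc : p₁ < 1 - p₂ := by linarith
  have hpc' : p₂ < 1 - p₁ := by linarith
  have hF0 : p₁ ≤ cdfZ μ ((s : ℤ) - 1) := hp₁ ▸ cdfZ_zero_le_pred μ (hp₁ ▸ hpc) hs'
  have hG0 : p₂ ≤ cdfZ ν ((t : ℤ) - 1) := hp₂ ▸ cdfZ_zero_le_pred ν (hp₂ ▸ hpc') ht'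
  have ic : ∀ c a b : ℝ, IntervalIntegrable (fun _ => c) volume a b := fun c a b =>
    intervalIntegrable_const
  have iα := intervalIntegrable_score μ hm₁ hc
  have iβ := intervalIntegrable_score_one_sub ν hm₁ hc
  have iαβ := intervalIntegrable_score_mul_one_sub μ ν hm₁ hc
  have iα' := intervalIntegrable_score μ hm₁ hG
  have iβ' := intervalIntegrable_score_one_sub ν hF hc
  have expand : ∀ u, (score μ u + (p₂ - p₁)) * (score ν (1 - u) + (p₁ - p₂))
      = score μ u * score ν (1 - u) - (p₂ - p₁) * score μ u + (p₂ - p₁) * score ν (1 - u)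
        - (p₂ - p₁) ^ 2 := fun u => by ring
  have iall : IntervalIntegrable
      (fun u => (score μ u + (p₂ - p₁)) * (score ν (1 - u) + (p₁ - p₂))) volume p₁ (1 - p₂) := by
    simp_rw [expand]
    exact ((iαβ.sub (iα.const_mul _)).add (iβ.const_mul _)).sub (ic _ _ _)
  -- The cut atom of `μ` occupies the right end. That of `ν`, read at `1 - u`, occupies the left
  -- end, so the overlap is where the two cut atoms meet.
  have hJ := integral_mul_shift (P := fun u => score μ u + (p₂ - p₁))
    (Q := fun u => score ν (1 - u) + (p₁ - p₂)) (x := cdfZ μ ((s : ℤ) - 1))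
    (y := 1 - cdfZ ν ((t : ℤ) - 1)) (k := 1 - cdfZ μ s - p₂) (l := 1 - cdfZ ν t - p₁)
    (f := fun u => (clip p₁ (1 - p₂) (cdfZ μ (quantile μ u))
          + clip p₁ (1 - p₂) (cdfZ μ ((quantile μ u : ℤ) - 1)) - (1 - p₂ - p₁))
        * (clip p₂ (1 - p₁) (cdfZ ν (quantile ν (1 - u)))
          + clip p₂ (1 - p₁) (cdfZ ν ((quantile ν (1 - u) : ℤ) - 1)) - (1 - p₂ - p₁)))
    ⟨hF0, hs⟩ ⟨by linarith, by linarith⟩ (iα.add (ic _ _ _)) (iβ.add (ic _ _ _)) iall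
    (fun u hu _ => by
      have hu' : u ∈ Set.Ioo (0 : ℝ) 1 := ⟨hm₁.1.trans_lt hu.1, hu.2.trans_le hc.2⟩
      rw [clip_add_clip_eq_score_of_lt μ hp₁ hs hs' hpc hu' hu.1 hu.2, sub_right_comm 1 p₂ p₁,
        clip_add_clip_eq_score_of_lt ν hp₂ ht ht' hpc' (one_sub_mem hu') (by linarith [hu.2])
          (by linarith [hu.1])]
      simp only [lt_sub_comm])
  have hE : ∫ u in p₁..(1 - p₂), (score μ u + (p₂ - p₁)) * (score ν (1 - u) + (p₁ - p₂))
      = (∫ u in p₁..(1 - p₂), score μ u * score ν (1 - u))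
        - (p₂ - p₁) * (∫ u in p₁..(1 - p₂), score μ u)
        + (p₂ - p₁) * (∫ u in p₁..(1 - p₂), score ν (1 - u))
        - (p₂ - p₁) ^ 2 * (1 - p₂ - p₁) := by
    simp_rw [expand]
    rw [intervalIntegral.integral_sub ((iαβ.sub (iα.const_mul _)).add (iβ.const_mul _)) (ic _ _ _),
      intervalIntegral.integral_add (iαβ.sub (iα.const_mul _)) (iβ.const_mul _),
      intervalIntegral.integral_sub iαβ (iα.const_mul _), intervalIntegral.integral_const_mul,
      intervalIntegral.integral_const_mul, intervalIntegral.integral_const, smul_eq_mul]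
    ring
  have hB : ∫ u in cdfZ μ ((s : ℤ) - 1)..(1 - p₂), (score ν (1 - u) + (p₁ - p₂))
      = (∫ u in cdfZ μ ((s : ℤ) - 1)..(1 - p₂), score ν (1 - u))
        + (p₁ - p₂) * (1 - p₂ - cdfZ μ ((s : ℤ) - 1)) := by
    rw [intervalIntegral.integral_add iβ' (ic _ _ _), intervalIntegral.integral_const, smul_eq_mul]
    ring
  have hA : ∫ u in p₁..(1 - cdfZ ν ((t : ℤ) - 1)), (score μ u + (p₂ - p₁))
      = (∫ u in p₁..(1 - cdfZ ν ((t : ℤ) - 1)), score μ u)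
        + (p₂ - p₁) * (1 - cdfZ ν ((t : ℤ) - 1) - p₁) := by
    rw [intervalIntegral.integral_add iα' (ic _ _ _), intervalIntegral.integral_const, smul_eq_mul]
    ring
  have left : ∫ u in 0..p₁, score μ u * score ν (1 - u)
      = (p₁ - 1) * ∫ u in 0..p₁, score ν (1 - u) := by
    rw [← intervalIntegral.integral_const_mul]
    refine intervalIntegral.integral_congr_uIoo fun u hu => ?_
    rw [Set.uIoo_of_le hm₁.1] at hu
    rw [score_of_le_zero μ ⟨hu.1, hu.2.trans_le hm₁.2⟩ (hp₁ ▸ hu.2.le), hp₁]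
  have right : ∫ u in (1 - p₂)..1, score μ u * score ν (1 - u)
      = (p₂ - 1) * ∫ u in (1 - p₂)..1, score μ u := by
    rw [← intervalIntegral.integral_const_mul]
    refine intervalIntegral.integral_congr_uIoo fun u hu => ?_
    rw [Set.uIoo_of_le hc.2] at hu
    rw [score_of_le_zero ν (one_sub_mem ⟨hc.1.trans_lt hu.1, hu.2⟩)
      (by rw [← hp₂]; linarith [hu.1]), ← hp₂, mul_comm]
  have hsplit₁ := intervalIntegral.integral_add_adjacent_intervals
    (intervalIntegrable_score_mul_one_sub μ ν h0 hm₁) iαβ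
  have hsplit₂ := intervalIntegral.integral_add_adjacent_intervals
    (intervalIntegrable_score_mul_one_sub μ ν h0 hc)
    (intervalIntegrable_score_mul_one_sub μ ν hc h1)
  have z₁ := integral_score_zero μ
  have z₂ := integral_score_zero ν
  rw [← hp₁] at z₁
  rw [← hp₂] at z₂
  rw [hJ, hE, hB, hA, ← hsplit₂, ← hsplit₁, left, right, integral_score_one_sub ν h0 hm₁,
    integral_score_one_sub ν hm₁ hc, integral_score_one_sub ν hF hc, integral_score_sub μ hc h1,
    integral_score_sub μ hm₁ hc, integral_score_sub μ hm₁ hG, sub_zero, sub_sub_cancel,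
    integral_score_one, integral_score_one, z₁, z₂]
  ring

/-! ### Degenerate cases, comparison of crossing points, assembly. -/

lemma crossing_le {c d : ℝ} {a b : ℕ} (ha : cdfZ μ ((a : ℤ) - 1) ≤ c) (hb : d < cdfZ μ b)
    (hcd : c ≤ d) : a ≤ b := by
  by_contra h
  have := cdfZ_mono μ (show (b : ℤ) ≤ (a : ℤ) - 1 by omega)
  linarith

/-- Below `p₁` the first coordinate is zero and above it the second is, so one score is constant on
each piece. -/
lemma integral_score_degenerate (hp : 1 ≤ cdfZ μ 0 + cdfZ ν 0) :
    ∫ u in 0..1, score μ u * score ν (1 - u) = - ((1 - cdfZ μ 0) * (1 - cdfZ ν 0)) := by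
  have h0 : (0 : ℝ) ∈ Set.Icc (0 : ℝ) 1 := Set.left_mem_Icc.2 zero_le_one
  have h1 : (1 : ℝ) ∈ Set.Icc (0 : ℝ) 1 := Set.right_mem_Icc.2 zero_le_one
  have hm := cdfZ_mem μ 0
  have left : ∫ u in 0..cdfZ μ 0, score μ u * score ν (1 - u)
      = (cdfZ μ 0 - 1) * ∫ u in 0..cdfZ μ 0, score ν (1 - u) := by
    rw [← intervalIntegral.integral_const_mul]
    refine intervalIntegral.integral_congr_uIoo fun u hu => ?_
    rw [Set.uIoo_of_le hm.1] at hu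
    rw [score_of_le_zero μ ⟨hu.1, hu.2.trans_le hm.2⟩ hu.2.le]
  have right : ∫ u in cdfZ μ 0..1, score μ u * score ν (1 - u)
      = (cdfZ ν 0 - 1) * ∫ u in cdfZ μ 0..1, score μ u := by
    rw [← intervalIntegral.integral_const_mul]
    refine intervalIntegral.integral_congr_uIoo fun u hu => ?_
    rw [Set.uIoo_of_le hm.2] at hu
    rw [score_of_le_zero ν (one_sub_mem ⟨hm.1.trans_lt hu.1, hu.2⟩) (by linarith [hu.1]), mul_comm]
  have hstep : ∫ u in 0..(1 - cdfZ μ 0), score ν u = (1 - cdfZ μ 0) * (cdfZ ν 0 - 1) := by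
    have hz := cdfZ_of_neg ν (by norm_num : (0 : ℤ) - 1 < 0)
    rw [integral_score_step ν (x := 0) hz.le (by linarith [hm.2]) (by linarith), hz]
    ring
  rw [← intervalIntegral.integral_add_adjacent_intervals
    (intervalIntegrable_score_mul_one_sub μ ν h0 hm)
    (intervalIntegrable_score_mul_one_sub μ ν hm h1), left, right,
    integral_score_one_sub ν h0 hm, integral_score_sub μ hm h1, integral_score_one, sub_zero,
    integral_score_one, integral_score_zero, hstep]
  ring

/-- The hypothesis forces `F s = 1`, so both sides vanish. The right side is left unsimplified to
match the primitive formula with `g = g' = 1`. -/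
lemma integral_score_of_forall_lt {s : ℕ}
    (h : ∀ y : ℕ, cdfZ ν y < cdfZ μ s) :
    ∫ u in 0..cdfZ μ s, score ν u = 1 ^ 2 - 1 + (cdfZ μ s - 1) * (1 + 1 - 1) := by
  have h1 : cdfZ μ s = 1 := by
    refine le_antisymm (cdfZ_le_one μ _) (not_lt.1 fun hlt => ?_)
    obtain ⟨n, hn⟩ := exists_lt_cdfZ ν hlt
    exact lt_asymm hn (h n)
  rw [h1, integral_score_one]
  ring

lemma rhoPosMax_add_eq {m : ℝ} (hm : m = cdfZ ν 0) (hle : cdfZ μ 0 ≤ m) {s : ℕ}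
    (hs : cdfZ μ ((s : ℤ) - 1) ≤ m) (hs' : m < cdfZ μ s) {g g' : ℝ}
    (hg : ∫ u in 0..cdfZ μ s, score ν u = g' ^ 2 - g' + (cdfZ μ s - g') * (g + g' - 1)) :
    (1 - m) ^ 3 * rhoPosMax μ ν + 3 * m * (1 - m)
        + 3 * (m - cdfZ μ ((s : ℤ) - 1)) * (cdfZ μ s * (m - g - g') + g * g')
      = 3 * ∫ u in 0..1, score μ u * score ν u := by
  rw [rhoPosMax_eq μ ν (by rw [← hm, max_eq_right hle]) (hs'.trans_le (cdfZ_le_one μ _))]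
  simp_rw [mul_comm (score μ _)]
  rw [integral_upper μ ν hm hs hs' hg]
  simp_rw [mul_comm (clip m 1 (cdfZ ν _) + _ - _)]

end

/-- This allows the case `p₁ > p₂` to be deduced by exchanging the margins. -/
lemma mul_rhoPosMax_comm (μ ν : Measure ℕ) [IsProbabilityMeasure μ] [IsProbabilityMeasure ν]
    {m : ℝ} (hm : m = max (cdfZ μ 0) (cdfZ ν 0)) (hm1 : m < 1) :
    (1 - m) ^ 3 * rhoPosMax μ ν = (1 - m) ^ 3 * rhoPosMax ν μ := by
  rw [rhoPosMax_eq μ ν hm hm1, rhoPosMax_eq ν μ (by rw [hm, max_comm]) hm1]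
  simp_rw [mul_comm (clip m 1 (cdfZ ν _) + _ - _)]

lemma rhoPosMin_add_eq (μ ν : Measure ℕ) [IsProbabilityMeasure μ] [IsProbabilityMeasure ν]
    {p₁ p₂ : ℝ} (hp₁ : p₁ = cdfZ μ 0) (hp₂ : p₂ = cdfZ ν 0) (hp : p₁ + p₂ < 1)
    {s u t v : ℕ} (hs : cdfZ μ ((s : ℤ) - 1) ≤ 1 - p₂) (hs' : 1 - p₂ < cdfZ μ s)
    (hu : cdfZ ν ((u : ℤ) - 1) ≤ 1 - cdfZ μ ((s : ℤ) - 1))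
    (hu' : 1 - cdfZ μ ((s : ℤ) - 1) < cdfZ ν u)
    (ht : cdfZ ν ((t : ℤ) - 1) ≤ 1 - p₁) (ht' : 1 - p₁ < cdfZ ν t)
    (hv : cdfZ μ ((v : ℤ) - 1) ≤ 1 - cdfZ ν ((t : ℤ) - 1))
    (hv' : 1 - cdfZ ν ((t : ℤ) - 1) < cdfZ μ v) {w : ℤ → ℤ → ℝ}
    (hw : w = fun x y => 1 - cdfZ μ x - cdfZ ν y) :
    w 0 0 ^ 3 * rhoPosMin μ ν + 3 * w 0 0 * (p₁ * p₂ - p₁ - p₂) - 3 * p₁ * p₂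
        + 3 * w (s - 1) (u - 1) * w s 0 * w 0 t * (if s = v then 1 else 0)
        - 3 * w s 0 * (p₂ * w (s - 1) 0 + (cdfZ ν (u - 1) - p₂) ^ 2
            + w (s - 1) (u - 1) * (min (1 - p₁) (cdfZ ν u) - 2 * p₂ + cdfZ ν (u - 1)))
        - 3 * w 0 t * (p₁ * w 0 (t - 1) + (cdfZ μ (v - 1) - p₁) ^ 2
            + w (v - 1) (t - 1) * (min (1 - p₂) (cdfZ μ v) - 2 * p₁ + cdfZ μ (v - 1)))
      = 3 * ∫ x in 0..1, score μ x * score ν (1 - x) := by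
  have hw0 : w 0 0 = 1 - p₂ - p₁ := by
    rw [hw, hp₁, hp₂]
    ring
  have hF0 : p₁ ≤ cdfZ μ ((s : ℤ) - 1) :=
    hp₁ ▸ cdfZ_zero_le_pred μ (c := 1 - p₂) (by linarith) hs'
  have hG0 : p₂ ≤ cdfZ ν ((t : ℤ) - 1) :=
    hp₂ ▸ cdfZ_zero_le_pred ν (c := 1 - p₁) (by linarith) ht'
  rw [hw0, rhoPosMin_eq μ ν hp₁ hp₂ (by linarith),
    integral_lower μ ν hp₁ hp₂ hp hs hs' ht ht', integral_score ν ht ht'.le,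
    integral_score μ hs hs'.le, integral_score ν hu hu'.le, integral_score μ hv hv'.le]
  simp only [hw, ← hp₁, ← hp₂]
  have hvs : v ≤ s := crossing_le μ hv hs' (by linarith)
  have hut : u ≤ t := crossing_le ν hu ht' (by linarith)
  by_cases hsv : s = v
  · subst hsv
    -- With `s = v` the bound on `F (v - 1)` says `F (s - 1) + G (t - 1) ≤ 1`: the cut atoms meet,
    -- the `max` is its first argument and both minima are the truncation levels.
    obtain rfl : u = t := le_antisymm hut (crossing_le ν (by linarith) hu' le_rfl)
    rw [if_pos rfl, min_eq_left ht'.le, min_eq_left hs'.le, max_eq_left (by linarith)]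
    ring
  -- Now `v < s`, so `1 - G (t - 1) < F v ≤ F (s - 1)`: the overlap is empty and the minima are `F
  -- v` and `G u`.
  · have hvs' : cdfZ μ v ≤ cdfZ μ ((s : ℤ) - 1) := cdfZ_mono μ (by omega)
    have hut' : cdfZ ν u ≤ cdfZ ν ((t : ℤ) - 1) := by
      refine cdfZ_mono ν (not_lt.1 fun h => ?_)
      have := cdfZ_mono ν (show (t : ℤ) - 1 ≤ (u : ℤ) - 1 by omega)
      linarith
    rw [if_neg hsv, min_eq_right (hut'.trans ht), min_eq_right (hvs'.trans hs),
      max_eq_right (by linarith)]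
    ring

end ZeroInflated

end

open ZeroInflated in
theorem proposition1 (μ ν : MeasureTheory.Measure ℕ)
    [MeasureTheory.IsProbabilityMeasure μ] [MeasureTheory.IsProbabilityMeasure ν]
    (F G : ℤ → ℝ) (hF : F = ZeroInflated.cdfZ μ) (hG : G = ZeroInflated.cdfZ ν)
    (p₁ p₂ : ℝ) (hp₁ : p₁ = μ.real {0}) (hp₂ : p₂ = ν.real {0})
    (w : ℤ → ℤ → ℝ) (hw : w = fun x y => 1 - F x - G y)
    (rmax rmin : ℝ) (hrmax : rmax = ZeroInflated.rhoPosMax μ ν)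
    (hrmin : rmin = ZeroInflated.rhoPosMin μ ν) :
    -- upper bound, `p₁ ≤ p₂`
    (p₁ ≤ p₂ → ∀ s : ℕ, F (s - 1) ≤ p₂ → p₂ < F s →
      (∀ u : ℕ, G (u - 1) < F s → F s ≤ G u →
        IsGreatest (ZeroInflated.rhoRange μ ν)
          ((1 - p₂) ^ 3 * rmax + 3 * p₂ * (1 - p₂)
            + 3 * (p₂ - F (s - 1)) * (F s * (p₂ - G u - G (u - 1)) + G u * G (u - 1)))) ∧
      -- no such `u` exists: `G(u)` and `G(u - 1)` are read as `1`
      ((∀ y : ℕ, G y < F s) →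
        IsGreatest (ZeroInflated.rhoRange μ ν)
          ((1 - p₂) ^ 3 * rmax + 3 * p₂ * (1 - p₂)
            + 3 * (p₂ - F (s - 1)) * (F s * (p₂ - 1 - 1) + 1 * 1)))) ∧
    -- upper bound, `p₁ > p₂`
    (p₁ > p₂ → ∀ t : ℕ, G (t - 1) ≤ p₁ → p₁ < G t →
      (∀ v : ℕ, F (v - 1) < G t → G t ≤ F v →
        IsGreatest (ZeroInflated.rhoRange μ ν)
          ((1 - p₁) ^ 3 * rmax + 3 * p₁ * (1 - p₁)
            + 3 * (p₁ - G (t - 1)) * (G t * (p₁ - F v - F (v - 1)) + F v * F (v - 1)))) ∧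
      -- no such `v` exists: `F(v)` and `F(v - 1)` are read as `1`
      ((∀ x : ℕ, F x < G t) →
        IsGreatest (ZeroInflated.rhoRange μ ν)
          ((1 - p₁) ^ 3 * rmax + 3 * p₁ * (1 - p₁)
            + 3 * (p₁ - G (t - 1)) * (G t * (p₁ - 1 - 1) + 1 * 1)))) ∧
    -- lower bound, `p₁ + p₂ ≥ 1`
    (p₁ + p₂ ≥ 1 →
      IsLeast (ZeroInflated.rhoRange μ ν) (-3 * (1 - p₁) * (1 - p₂))) ∧
    -- lower bound, `p₁ + p₂ < 1`
    (p₁ + p₂ < 1 → ∀ s u t v : ℕ,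
      F (s - 1) ≤ 1 - p₂ → 1 - p₂ < F s →
      G (u - 1) ≤ 1 - F (s - 1) → 1 - F (s - 1) < G u →
      G (t - 1) ≤ 1 - p₁ → 1 - p₁ < G t →
      F (v - 1) ≤ 1 - G (t - 1) → 1 - G (t - 1) < F v →
      ∀ I₁ I₂ : ℝ, I₁ = min (1 - p₂) (F v) → I₂ = min (1 - p₁) (G u) →
        IsLeast (ZeroInflated.rhoRange μ ν)
          (w 0 0 ^ 3 * rmin + 3 * w 0 0 * (p₁ * p₂ - p₁ - p₂) - 3 * p₁ * p₂
            + 3 * w (s - 1) (u - 1) * w s 0 * w 0 t * (if s = v then 1 else 0)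
            - 3 * w s 0 * (p₂ * w (s - 1) 0 + (G (u - 1) - p₂) ^ 2
                + w (s - 1) (u - 1) * (I₂ - 2 * p₂ + G (u - 1)))
            - 3 * w 0 t * (p₁ * w 0 (t - 1) + (F (v - 1) - p₁) ^ 2
                + w (v - 1) (t - 1) * (I₁ - 2 * p₁ + F (v - 1))))) := by 
  subst hF hG hrmax hrmin hw
  rw [← cdfZ_zero] at hp₁ hp₂
  have hub := isGreatest_upper μ ν
  have hlb := isLeast_lower μ ν
  refine ⟨fun h s hs hs' => ?_, fun h t ht ht' => ?_, fun h => ?_, ?_⟩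
  · have key := fun g g' => rhoPosMax_add_eq μ ν hp₂ (hp₁ ▸ h) hs hs' (g := g) (g' := g')
    refine ⟨fun u hu hu' => ?_, fun hy => ?_⟩
    · rw [key _ _ (integral_score ν hu.le hu')]
      exact hub
    · rw [key 1 1 (integral_score_of_forall_lt μ ν hy)]
      exact hub
  · have key := fun g g' => rhoPosMax_add_eq ν μ hp₁ (hp₂ ▸ h.le) ht ht' (g := g) (g' := g')
    rw [mul_rhoPosMax_comm μ ν (m := p₁) (by rw [← hp₁, ← hp₂, max_eq_left h.le])
      (ht'.trans_le (cdfZ_le_one ν _))]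
    simp_rw [mul_comm (score ν _)] at key
    refine ⟨fun v hv hv' => ?_, fun hy => ?_⟩
    · rw [key _ _ (integral_score μ hv.le hv')]
      exact hub
    · rw [key 1 1 (integral_score_of_forall_lt ν μ hy)]
      exact hub
  · have hd := integral_score_degenerate μ ν (by rw [← hp₁, ← hp₂]; exact h)
    rw [← hp₁, ← hp₂] at hd
    simp only [score] at hd
    rw [hd] at hlb
    convert hlb using 1
    ring
  · intro h s u t v hs hs' hu hu' ht ht' hv hv' I₁ I₂ hI₁ hI₂
    rw [hI₁, hI₂, rhoPosMin_add_eq μ ν hp₁ hp₂ h hs hs' hu hu' ht ht' hv hv' rfl]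
    exact hlb
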